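/- Let $\Gamma\rightrightarrows\Gamma_0$ be a proper étale Lie groupoid, presenting an orbifold: $\Gamma$ and $\Gamma_0$ are finite-dimensional Hausdorff smooth manifolds, $\Gamma_0$ is second countable, the source map $\beta:\Gamma\to\Gamma_0$ and the target map $\alpha:\Gamma\to\Gamma_0$ are local diffeomorphisms, and $(\alpha,\beta):\Gamma\to\Gamma_0\times\Gamma_0$ is a proper map. Let $G$ be a (finite-dimensional) Lie group with Lie algebra $\mathfrak g$, and let $P\xrightarrow{\pi}\Gamma_0$ be a principal $G$-bundle over $\Gamma\rightrightarrows\Gamma_0$, that is, a smooth principal right $G$-bundle over $\Gamma_0$ together with a smooth left action $Q\to P$, $(\gamma,p)\mapsto\gamma\cdot p$, of the groupoid, where $Q=\Gamma\times_{\beta,\Gamma_0,\pi}P$, with $\pi(\gamma\cdot p)=\alpha(\gamma)$, $\pi(p)\cdot p=p$ and $\gamma_1\cdot(\gamma_2\cdot p)=(\gamma_1\gamma_2)\cdot p$ whenever defined, and which commutes with the action of $G$: $(\gamma\cdot p)\cdot g=\gamma\cdot(p\cdot g)$. Then $P$ admits a connection: there is a connection 1-form $\theta\in\Omega^1(P)\otimes\mathfrak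 g$ of the principal bundle $P\to\Gamma_0$ such that $\partial\theta=0$, where $\partial\theta\in\Omega^1(Q)\otimes\mathfrak g$ is the pull-back of $\theta$ under $(\gamma,p)\mapsto p$ minus the pull-back of $\theta$ under $(\gamma,p)\mapsto\gamma\cdot p$. -/

import Mathlib

open scoped Manifold ContDiff

noncomputable section

/-- A Lie groupoid `Γ ⇉ M` on smooth manifolds `Γ` (arrows) and `M` (units), with source `src`
and target `tgt`.  The product `mul g h` is meaningful only if `src g = tgt h`; its values at other
pairs are irrelevant, and no condition is put on them.  As `src` and `tgt` are submersions, the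
composable pairs form an embedded submanifold of `Γ × Γ`, and a map on an embedded submanifold is
smooth exactly if it is `ContMDiffOn` it. -/
structure LieGroupoid (E₀ M E₁ Γ : Type*)
    [NormedAddCommGroup E₀] [NormedSpace ℝ E₀] [TopologicalSpace M] [ChartedSpace E₀ M]
    [NormedAddCommGroup E₁] [NormedSpace ℝ E₁] [TopologicalSpace Γ] [ChartedSpace E₁ Γ] where
  src : Γ → M
  tgt : Γ → M
  one : M → Γ
  inv : Γ → Γ
  mul : Γ → Γ → Γ
  src_one : ∀ x, src (one x) = x
  tgt_one : ∀ x, tgt (one x) = x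
  src_inv : ∀ g, src (inv g) = tgt g
  tgt_inv : ∀ g, tgt (inv g) = src g
  src_mul : ∀ g h, src g = tgt h → src (mul g h) = src h
  tgt_mul : ∀ g h, src g = tgt h → tgt (mul g h) = tgt g
  one_mul : ∀ g, mul (one (tgt g)) g = g
  mul_one : ∀ g, mul g (one (src g)) = g
  mul_assoc : ∀ g h k, src g = tgt h → src h = tgt k → mul (mul g h) k = mul g (mul h k)
  mul_inv : ∀ g, mul g (inv g) = one (tgt g)
  inv_mul : ∀ g, mul (inv g) g = one (src g)
  src_submersion : Manifold.IsSubmersion 𝓘(ℝ, E₁) 𝓘(ℝ, E₀) ∞ src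
  tgt_submersion : Manifold.IsSubmersion 𝓘(ℝ, E₁) 𝓘(ℝ, E₀) ∞ tgt
  smooth_one : ContMDiff 𝓘(ℝ, E₀) 𝓘(ℝ, E₁) ∞ one
  smooth_inv : ContMDiff 𝓘(ℝ, E₁) 𝓘(ℝ, E₁) ∞ inv
  smooth_mul : ContMDiffOn (𝓘(ℝ, E₁).prod 𝓘(ℝ, E₁)) 𝓘(ℝ, E₁) ∞
    (fun q : Γ × Γ => mul q.1 q.2) {q : Γ × Γ | src q.1 = tgt q.2}

namespace LieGroupoid

variable {E₀ M E₁ Γ : Type*}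
  [NormedAddCommGroup E₀] [NormedSpace ℝ E₀] [TopologicalSpace M] [ChartedSpace E₀ M]
  [NormedAddCommGroup E₁] [NormedSpace ℝ E₁] [TopologicalSpace Γ] [ChartedSpace E₁ Γ]

/-- A Lie groupoid is étale if its source and target maps are local diffeomorphisms. -/
def IsEtale (𝒢 : LieGroupoid E₀ M E₁ Γ) : Prop :=
  IsLocalDiffeomorph 𝓘(ℝ, E₁) 𝓘(ℝ, E₀) ∞ 𝒢.src ∧ IsLocalDiffeomorph 𝓘(ℝ, E₁) 𝓘(ℝ, E₀) ∞ 𝒢.tgt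

/-- A Lie groupoid is proper if `(tgt, src) : Γ → M × M` is a proper map. -/
def IsProper (𝒢 : LieGroupoid E₀ M E₁ Γ) : Prop :=
  IsProperMap fun g : Γ => (𝒢.tgt g, 𝒢.src g)

end LieGroupoid

/-- A smooth principal right `G`-bundle `proj : P → M`: a smooth right action `act p g = p · g` of
`G` on `P` along the fibres of `proj`, with `G`-equivariant smooth local trivializations. -/
structure SmoothPrincipalBundle (E₀ M EG G EP P : Type*)
    [NormedAddCommGroup E₀] [NormedSpace ℝ E₀] [TopologicalSpace M] [ChartedSpace E₀ M]
    [NormedAddCommGroup EG] [NormedSpace ℝ EG] [TopologicalSpace G] [ChartedSpace EG G] [Group G]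
    [NormedAddCommGroup EP] [NormedSpace ℝ EP] [TopologicalSpace P] [ChartedSpace EP P] where
  proj : P → M
  act : P → G → P
  smooth_proj : ContMDiff 𝓘(ℝ, EP) 𝓘(ℝ, E₀) ∞ proj
  smooth_act : ContMDiff (𝓘(ℝ, EP).prod 𝓘(ℝ, EG)) 𝓘(ℝ, EP) ∞ fun q : P × G => act q.1 q.2
  act_one : ∀ p, act p 1 = p
  act_mul : ∀ p g h, act p (g * h) = act (act p g) h
  proj_act : ∀ p g, proj (act p g) = proj p
  locally_trivial : ∀ x : M, ∃ e : Bundle.Trivialization G proj, x ∈ e.baseSet ∧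
    ContMDiffOn 𝓘(ℝ, EP) (𝓘(ℝ, E₀).prod 𝓘(ℝ, EG)) ∞ e e.source ∧
    ContMDiffOn (𝓘(ℝ, E₀).prod 𝓘(ℝ, EG)) 𝓘(ℝ, EP) ∞ e.toOpenPartialHomeomorph.symm e.target ∧
    ∀ p ∈ e.source, ∀ g : G, e (act p g) = ((e p).1, (e p).2 * g)

/-- The adjoint representation `Ad g` of a Lie group: the differential at `1` of conjugation
`h ↦ g * h * g⁻¹`. -/
def lieAd (EG : Type*) {G : Type*} [NormedAddCommGroup EG] [NormedSpace ℝ EG]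
    [TopologicalSpace G] [ChartedSpace EG G] [Group G] (g : G) :
    GroupLieAlgebra 𝓘(ℝ, EG) G →L[ℝ] GroupLieAlgebra 𝓘(ℝ, EG) G :=
  mfderiv 𝓘(ℝ, EG) 𝓘(ℝ, EG) (fun h : G => g * h * g⁻¹) 1

namespace SmoothPrincipalBundle

variable {E₀ M EG G EP P : Type*}
  [NormedAddCommGroup E₀] [NormedSpace ℝ E₀] [TopologicalSpace M] [ChartedSpace E₀ M]
  [NormedAddCommGroup EG] [NormedSpace ℝ EG] [TopologicalSpace G] [ChartedSpace EG G] [Group G]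
  [NormedAddCommGroup EP] [NormedSpace ℝ EP] [TopologicalSpace P] [ChartedSpace EP P]

/-- The fundamental vector field on `P` of an element `X` of the Lie algebra: the image of `X`
under the differential at `1` of the orbit map `g ↦ p · g`.  It lies in the tangent space at
`p · 1 = p`. -/
def fundamental (B : SmoothPrincipalBundle E₀ M EG G EP P) (p : P)
    (X : GroupLieAlgebra 𝓘(ℝ, EG) G) : TangentSpace 𝓘(ℝ, EP) p :=
  mfderiv 𝓘(ℝ, EG) 𝓘(ℝ, EP) (fun g : G => B.act p g) 1 X

/-- A Lie algebra valued differential 1-form `θ` on `P` is a connection form of the principal bundle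
if it is smooth (as a function on the tangent bundle, linear on the fibres), if it reproduces the
generators of the fundamental vector fields, and if the pull-back of `θ` under right
translation by `g` is `Ad g⁻¹ ∘ θ`. -/
structure IsConnectionForm [IsManifold 𝓘(ℝ, EP) ∞ P]
    (B : SmoothPrincipalBundle E₀ M EG G EP P)
    (θ : ∀ p : P, TangentSpace 𝓘(ℝ, EP) p →L[ℝ] GroupLieAlgebra 𝓘(ℝ, EG) G) : Prop where
  smooth : ContMDiff 𝓘(ℝ, EP).tangent 𝓘(ℝ, EG) ∞ (M' := EG)
    (fun v => θ v.proj v.2 : TangentBundle 𝓘(ℝ, EP) P → EG)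
  apply_fundamental : ∀ (p : P) (X : GroupLieAlgebra 𝓘(ℝ, EG) G), θ p (B.fundamental p X) = X
  equivariant : ∀ (p : P) (g : G) (v : TangentSpace 𝓘(ℝ, EP) p),
    θ (B.act p g) (mfderiv 𝓘(ℝ, EP) 𝓘(ℝ, EP) (fun r : P => B.act r g) p v) =
      lieAd EG g⁻¹ (θ p v)

end SmoothPrincipalBundle

/-- A principal `G`-bundle over a Lie groupoid `Γ ⇉ M`: a principal right `G`-bundle `P → M` with a
smooth left action `gact γ p = γ · p` of the groupoid on `P → M` that commutes with the action of
`G`.  The action is meaningful only for `src γ = proj p`, that is, on the fibre product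
`Q = Γ ×_M P`, which is an embedded submanifold of `Γ × P` as `src` is a submersion. -/
structure GroupoidPrincipalBundle {E₀ M E₁ Γ : Type*}
    [NormedAddCommGroup E₀] [NormedSpace ℝ E₀] [TopologicalSpace M] [ChartedSpace E₀ M]
    [NormedAddCommGroup E₁] [NormedSpace ℝ E₁] [TopologicalSpace Γ] [ChartedSpace E₁ Γ]
    (𝒢 : LieGroupoid E₀ M E₁ Γ) (EG G EP P : Type*)
    [NormedAddCommGroup EG] [NormedSpace ℝ EG] [TopologicalSpace G] [ChartedSpace EG G] [Group G]
    [NormedAddCommGroup EP] [NormedSpace ℝ EP] [TopologicalSpace P] [ChartedSpace EP P]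
    extends SmoothPrincipalBundle E₀ M EG G EP P where
  gact : Γ → P → P
  proj_gact : ∀ γ p, 𝒢.src γ = proj p → proj (gact γ p) = 𝒢.tgt γ
  one_gact : ∀ p, gact (𝒢.one (proj p)) p = p
  mul_gact : ∀ γ₁ γ₂ p, 𝒢.src γ₁ = 𝒢.tgt γ₂ → 𝒢.src γ₂ = proj p →
    gact (𝒢.mul γ₁ γ₂) p = gact γ₁ (gact γ₂ p)
  gact_act : ∀ γ p g, 𝒢.src γ = proj p → gact γ (act p g) = act (gact γ p) g
  smooth_gact : ContMDiffOn (𝓘(ℝ, E₁).prod 𝓘(ℝ, EP)) 𝓘(ℝ, EP) ∞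
    (fun q : Γ × P => gact q.1 q.2) {q : Γ × P | 𝒢.src q.1 = proj q.2}

namespace GroupoidPrincipalBundle

variable {E₀ M E₁ Γ EG G EP P : Type*}
  [NormedAddCommGroup E₀] [NormedSpace ℝ E₀] [TopologicalSpace M] [ChartedSpace E₀ M]
  [NormedAddCommGroup E₁] [NormedSpace ℝ E₁] [TopologicalSpace Γ] [ChartedSpace E₁ Γ]
  [NormedAddCommGroup EG] [NormedSpace ℝ EG] [TopologicalSpace G] [ChartedSpace EG G] [Group G]
  [NormedAddCommGroup EP] [NormedSpace ℝ EP] [TopologicalSpace P] [ChartedSpace EP P]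
  {𝒢 : LieGroupoid E₀ M E₁ Γ}

/-- The arrow space `Q = Γ ×_M P` of the transformation groupoid `Q ⇉ P`, as a submanifold of
`Γ × P`.  Its source map is `(γ, p) ↦ p`, its target map is `(γ, p) ↦ γ · p`. -/
def Q (B : GroupoidPrincipalBundle 𝒢 EG G EP P) : Set (Γ × P) :=
  {q | 𝒢.src q.1 = B.proj q.2}

/-- The tangent space of the submanifold `Q = Γ ×_M P` at a point `(γ, p)`: all pairs `(u, v)` of
tangent vectors of `Γ` at `γ` and of `P` at `p` whose images in the tangent space of `M` at
`src γ = proj p` under the differentials of `src` and `proj` agree. -/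
def tangentQ (B : GroupoidPrincipalBundle 𝒢 EG G EP P) (q : B.Q) :
    Submodule ℝ (TangentSpace (𝓘(ℝ, E₁).prod 𝓘(ℝ, EP)) q.1) where
  carrier := {w : E₁ × EP | (mfderiv 𝓘(ℝ, E₁) 𝓘(ℝ, E₀) 𝒢.src q.1.1 w.1 : E₀) =
    mfderiv 𝓘(ℝ, EP) 𝓘(ℝ, E₀) B.proj q.1.2 w.2}
  add_mem' {w w'} h h' :=
    ((mfderiv 𝓘(ℝ, E₁) 𝓘(ℝ, E₀) 𝒢.src q.1.1).map_add w.1 w'.1).trans ((congrArg₂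
      (fun a b : E₀ => a + b) h h').trans
      ((mfderiv 𝓘(ℝ, EP) 𝓘(ℝ, E₀) B.proj q.1.2).map_add w.2 w'.2).symm)
  zero_mem' := (mfderiv 𝓘(ℝ, E₁) 𝓘(ℝ, E₀) 𝒢.src q.1.1).map_zero.trans
    (mfderiv 𝓘(ℝ, EP) 𝓘(ℝ, E₀) B.proj q.1.2).map_zero.symm
  smul_mem' c w h :=
    ((mfderiv 𝓘(ℝ, E₁) 𝓘(ℝ, E₀) 𝒢.src q.1.1).map_smul c w.1).trans ((congrArg
      (fun a : E₀ => c • a) h).trans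
      ((mfderiv 𝓘(ℝ, EP) 𝓘(ℝ, E₀) B.proj q.1.2).map_smul c w.2).symm)

/-- The differential on `T_q Q` of the source map `(γ, p) ↦ p` of `Q ⇉ P`. -/
def dSource (B : GroupoidPrincipalBundle 𝒢 EG G EP P) (q : B.Q) :
    B.tangentQ q →ₗ[ℝ] TangentSpace 𝓘(ℝ, EP) q.1.2 :=
  (mfderiv (𝓘(ℝ, E₁).prod 𝓘(ℝ, EP)) 𝓘(ℝ, EP) (fun r : Γ × P => r.2) q.1).toLinearMap.domRestrict
    (B.tangentQ q)

/-- The differential on `T_q Q` of the target map `(γ, p) ↦ γ · p` of `Q ⇉ P`.  The derivative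
of this map within `Q`, as a linear map on the tangent space of `Γ × P`, is determined on `T_q Q`
only, to which it is restricted here. -/
def dTarget (B : GroupoidPrincipalBundle 𝒢 EG G EP P) (q : B.Q) :
    B.tangentQ q →ₗ[ℝ] TangentSpace 𝓘(ℝ, EP) (B.gact q.1.1 q.1.2) :=
  (mfderivWithin (𝓘(ℝ, E₁).prod 𝓘(ℝ, EP)) 𝓘(ℝ, EP)
    (fun r : Γ × P => B.gact r.1 r.2) B.Q q.1).toLinearMap.domRestrict (B.tangentQ q)

/-- The Lie algebra valued 1-form `∂θ` on `Q`: the difference of the pull-backs of the 1-form `θ`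
on `P` under the source map and under the target map of the transformation groupoid `Q ⇉ P`. -/
def boundary (B : GroupoidPrincipalBundle 𝒢 EG G EP P)
    (θ : ∀ p : P, TangentSpace 𝓘(ℝ, EP) p →L[ℝ] GroupLieAlgebra 𝓘(ℝ, EG) G) (q : B.Q) :
    B.tangentQ q →ₗ[ℝ] GroupLieAlgebra 𝓘(ℝ, EG) G :=
  (θ q.1.2).toLinearMap ∘ₗ B.dSource q - (θ (B.gact q.1.1 q.1.2)).toLinearMap ∘ₗ B.dTarget q

/-- A pseudo-connection: a connection form of the principal bundle `P → M`, regardless of the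
action of the groupoid. -/
def IsPseudoConnection [IsManifold 𝓘(ℝ, EP) ∞ P]
    (B : GroupoidPrincipalBundle 𝒢 EG G EP P)
    (θ : ∀ p : P, TangentSpace 𝓘(ℝ, EP) p →L[ℝ] GroupLieAlgebra 𝓘(ℝ, EG) G) : Prop :=
  B.toSmoothPrincipalBundle.IsConnectionForm θ

/-- A connection on a principal bundle over a Lie groupoid: a pseudo-connection `θ` such that
`∂θ = 0`. -/
def IsConnection [IsManifold 𝓘(ℝ, EP) ∞ P]
    (B : GroupoidPrincipalBundle 𝒢 EG G EP P)
    (θ : ∀ p : P, TangentSpace 𝓘(ℝ, EP) p →L[ℝ] GroupLieAlgebra 𝓘(ℝ, EG) G) : Prop :=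
  B.IsPseudoConnection θ ∧ ∀ q : B.Q, B.boundary θ q = 0

end GroupoidPrincipalBundle

end

open scoped Manifold ContDiff

noncomputable section

open Filter Topology Set

/-! As the groupoid is étale, every arrow `γ` extends to a local section of the source map, unique
as a germ, and this section acts on `P` by a local diffeomorphism `translate γ`. Its differential
expresses the target differential on `Q` through the source differential (`dTarget_apply`), so `∂θ =
0` as soon as `θ` is invariant under all these local diffeomorphisms.

Invariance is obtained by summing over arrows. A flat connection form of a local trivialization, cut
off by a bump function `f` on the base, satisfies the axioms of a connection form except that it
sends the fundamental vector of `X` to `f • X`. The source fibres may be infinite, but by properness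
only finitely many arrows with a given source end in the compact support of `f`, and near that
source they move along finitely many local sections (`exists_finset_localSection`). Hence the sum of
all pull-backs is a smooth form. It is invariant because right multiplication by an arrow permutes
the terms (`formSum_dTranslate`), and its weight is the invariant function `fiberSum f`.

Countably many such forms have weights `f n` without a common zero. Coefficients `a n` with `∑ a n *
f n = 1` are built from the values of the weights alone (`exists_smooth_coefficients`). They are
therefore invariant as well, and no partition of unity on the orbit space is needed: `∑ a n • θ n`
is the connection. -/

theorem ContMDiffOn.contMDiffOn_tangentMap_of_isOpen {E F H H' M N : Type*}
    [NormedAddCommGroup E] [NormedSpace ℝ E] [TopologicalSpace H] {I : ModelWithCorners ℝ E H}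
    [TopologicalSpace M] [ChartedSpace H M] [IsManifold I ∞ M]
    [NormedAddCommGroup F] [NormedSpace ℝ F] [TopologicalSpace H'] {J : ModelWithCorners ℝ F H'}
    [TopologicalSpace N] [ChartedSpace H' N] [IsManifold J ∞ N]
    {f : M → N} {s : Set M} (hf : ContMDiffOn I J ∞ f s) (hs : IsOpen s) :
    ContMDiffOn I.tangent J.tangent ∞ (tangentMap I J f)
      ((fun v : TangentBundle I M => v.proj) ⁻¹' s) := by
  refine (hf.contMDiffOn_tangentMapWithin (m := ∞) (by simp) hs.uniqueMDiffOn).congr ?_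
  intro v hv
  exact (tangentMapWithin_eq_tangentMap (hs.uniqueMDiffOn _ hv)
    ((hf.contMDiffAt (hs.mem_nhds hv)).mdifferentiableAt (by simp))).symm

/-! ### Local sections of the source map of an étale groupoid -/

namespace LieGroupoid

variable {E₀ M E₁ Γ : Type*}
  [NormedAddCommGroup E₀] [NormedSpace ℝ E₀] [TopologicalSpace M] [ChartedSpace E₀ M]
  [NormedAddCommGroup E₁] [NormedSpace ℝ E₁] [TopologicalSpace Γ] [ChartedSpace E₁ Γ]
  {𝒢 : LieGroupoid E₀ M E₁ Γ}

/-- A local section of the source map of an étale groupoid through a given arrow. -/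
def IsEtale.localSection (h : 𝒢.IsEtale) (γ : Γ) : M → Γ := (h.1 γ).localInverse

/-- An open neighbourhood of `src γ` on which `localSection γ` is a section. -/
def IsEtale.sectionDomain (h : 𝒢.IsEtale) (γ : Γ) : Set M := (h.1 γ).localInverse.source

theorem IsEtale.isOpen_sectionDomain (h : 𝒢.IsEtale) (γ : Γ) : IsOpen (h.sectionDomain γ) :=
  (h.1 γ).localInverse_open_source

theorem IsEtale.src_mem_sectionDomain (h : 𝒢.IsEtale) (γ : Γ) : 𝒢.src γ ∈ h.sectionDomain γ :=
  (h.1 γ).localInverse_mem_source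

theorem IsEtale.sectionDomain_mem_nhds (h : 𝒢.IsEtale) (γ : Γ) :
    h.sectionDomain γ ∈ 𝓝 (𝒢.src γ) :=
  (h.isOpen_sectionDomain γ).mem_nhds (h.src_mem_sectionDomain γ)

theorem IsEtale.src_localSection (h : 𝒢.IsEtale) (γ : Γ) {x : M} (hx : x ∈ h.sectionDomain γ) :
    𝒢.src (h.localSection γ x) = x :=
  (h.1 γ).localInverse_right_inv hx

theorem IsEtale.localSection_src_eventually (h : 𝒢.IsEtale) (γ : Γ) :
    ∀ᶠ γ' in 𝓝 γ, h.localSection γ (𝒢.src γ') = γ' :=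
  (h.1 γ).localInverse_eventuallyEq_left

theorem IsEtale.localSection_src (h : 𝒢.IsEtale) (γ : Γ) : h.localSection γ (𝒢.src γ) = γ :=
  (h.localSection_src_eventually γ).self_of_nhds

theorem IsEtale.contMDiffOn_localSection (h : 𝒢.IsEtale) (γ : Γ) :
    ContMDiffOn 𝓘(ℝ, E₀) 𝓘(ℝ, E₁) ∞ (h.localSection γ) (h.sectionDomain γ) :=
  (h.1 γ).localInverse_contMDiffOn

theorem IsEtale.contMDiffAt_localSection (h : 𝒢.IsEtale) (γ : Γ) :
    ContMDiffAt 𝓘(ℝ, E₀) 𝓘(ℝ, E₁) ∞ (h.localSection γ) (𝒢.src γ) :=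
  (h.1 γ).localInverse_contMDiffAt

/-- The source map is injective near `s x`, so a continuous section is determined as a germ by its
value at `x`. All identities between germs of translations below rest on this. -/
theorem IsEtale.eventuallyEq_localSection (h : 𝒢.IsEtale) {s : M → Γ} {x : M}
    (hs : ContinuousAt s x) (hsec : ∀ᶠ y in 𝓝 x, 𝒢.src (s y) = y) :
    s =ᶠ[𝓝 x] h.localSection (s x) := by
  filter_upwards [hs.eventually (h.localSection_src_eventually (s x)), hsec] with y h1 h2
  rw [h2] at h1
  exact h1.symm

end LieGroupoid

/-! ### Local diffeomorphisms of the bundle induced by arrows -/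

namespace GroupoidPrincipalBundle

open LieGroupoid

variable {E₀ M E₁ Γ EG G EP P : Type*}
  [NormedAddCommGroup E₀] [NormedSpace ℝ E₀] [TopologicalSpace M] [ChartedSpace E₀ M]
  [NormedAddCommGroup E₁] [NormedSpace ℝ E₁] [TopologicalSpace Γ] [ChartedSpace E₁ Γ]
  [NormedAddCommGroup EG] [NormedSpace ℝ EG] [TopologicalSpace G] [ChartedSpace EG G] [Group G]
  [NormedAddCommGroup EP] [NormedSpace ℝ EP] [TopologicalSpace P] [ChartedSpace EP P]
  {𝒢 : LieGroupoid E₀ M E₁ Γ}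

/-- The local diffeomorphism of `P` given by the action of the local section through `γ`. -/
def translate (B : GroupoidPrincipalBundle 𝒢 EG G EP P) (h : 𝒢.IsEtale) (γ : Γ) (q : P) : P :=
  B.gact (h.localSection γ (B.proj q)) q

variable (B : GroupoidPrincipalBundle 𝒢 EG G EP P) (h : 𝒢.IsEtale)

theorem translate_apply {γ : Γ} {p : P} (hp : 𝒢.src γ = B.proj p) :
    B.translate h γ p = B.gact γ p := by
  rw [translate, ← hp, h.localSection_src]

theorem isOpen_proj_preimage {U : Set M} (hU : IsOpen U) : IsOpen (B.proj ⁻¹' U) :=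
  hU.preimage B.smooth_proj.continuous

theorem eventually_mem_sectionDomain {γ : Γ} {p : P} (hp : 𝒢.src γ = B.proj p) :
    ∀ᶠ q in 𝓝 p, B.proj q ∈ h.sectionDomain γ :=
  B.smooth_proj.continuous.continuousAt.eventually (hp ▸ h.sectionDomain_mem_nhds γ)

theorem contMDiffOn_translate (γ : Γ) :
    ContMDiffOn 𝓘(ℝ, EP) 𝓘(ℝ, EP) ∞ (B.translate h γ) (B.proj ⁻¹' h.sectionDomain γ) := by
  refine B.smooth_gact.comp (t := {q : Γ × P | 𝒢.src q.1 = B.proj q.2})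
    (f := fun q : P => (h.localSection γ (B.proj q), q)) ?_ ?_
  · exact ((h.contMDiffOn_localSection γ).comp B.smooth_proj.contMDiffOn fun _ hq => hq).prodMk
      contMDiffOn_id
  · intro q hq
    exact h.src_localSection γ hq

theorem contMDiffAt_translate {γ : Γ} {p : P} (hp : 𝒢.src γ = B.proj p) :
    ContMDiffAt 𝓘(ℝ, EP) 𝓘(ℝ, EP) ∞ (B.translate h γ) p :=
  (B.contMDiffOn_translate h γ).contMDiffAt (B.eventually_mem_sectionDomain h hp)

theorem mdifferentiableAt_translate {γ : Γ} {p : P} (hp : 𝒢.src γ = B.proj p) :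
    MDifferentiableAt 𝓘(ℝ, EP) 𝓘(ℝ, EP) (B.translate h γ) p :=
  (B.contMDiffAt_translate h hp).mdifferentiableAt (by simp)

/-- Near `p`, translating by any continuous local section through `γ` is `translate γ`. -/
theorem translate_localSection_eventuallyEq {γ : Γ} {p : P}
    (hp : B.proj p ∈ h.sectionDomain γ) :
    B.translate h (h.localSection γ (B.proj p)) =ᶠ[𝓝 p] B.translate h γ := by
  have h1 := h.eventuallyEq_localSection (s := h.localSection γ) (x := B.proj p)
    ((h.contMDiffOn_localSection γ).contMDiffAt
      ((h.isOpen_sectionDomain γ).mem_nhds hp)).continuousAt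
    (Filter.eventually_of_mem ((h.isOpen_sectionDomain γ).mem_nhds hp)
      fun y hy => h.src_localSection γ hy)
  filter_upwards [B.smooth_proj.continuous.continuousAt.eventually h1] with q hq
  simp only [translate, hq]

/-- The pointwise product of the two local sections is a continuous section through `mul γ δ`, so
uniqueness of germs identifies it with the chosen one. -/
theorem translate_mul_eventuallyEq {γ δ : Γ} {p : P} (hγδ : 𝒢.src γ = 𝒢.tgt δ)
    (hp : 𝒢.src δ = B.proj p) :
    B.translate h γ ∘ B.translate h δ =ᶠ[𝓝 p] B.translate h (𝒢.mul γ δ) := by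
  set x := B.proj p with hx
  have hδx : h.localSection δ x = δ := by rw [← hp, h.localSection_src]
  have hcδ : ContinuousAt (h.localSection δ) x :=
    hp ▸ (h.contMDiffAt_localSection δ).continuousAt
  have hct : ContinuousAt (fun y => 𝒢.tgt (h.localSection δ y)) x :=
    h.2.contMDiff.continuous.continuousAt.comp hcδ
  have hdγ : ∀ᶠ y in 𝓝 x, 𝒢.tgt (h.localSection δ y) ∈ h.sectionDomain γ := by
    refine hct.eventually (?_ : h.sectionDomain γ ∈ 𝓝 (𝒢.tgt (h.localSection δ x)))
    rw [hδx, ← hγδ]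
    exact h.sectionDomain_mem_nhds γ
  have hdδ : ∀ᶠ y in 𝓝 x, y ∈ h.sectionDomain δ := hp ▸ h.sectionDomain_mem_nhds δ
  let s : M → Γ := fun y =>
    𝒢.mul (h.localSection γ (𝒢.tgt (h.localSection δ y))) (h.localSection δ y)
  have hsx : s x = 𝒢.mul γ δ := by
    simp only [s, hδx, ← hγδ, h.localSection_src]
  have hcγ : ContinuousAt (fun y => h.localSection γ (𝒢.tgt (h.localSection δ y))) x := by
    refine ContinuousAt.comp (g := h.localSection γ) ?_ hct
    rw [hδx, ← hγδ]
    exact (h.contMDiffAt_localSection γ).continuousAt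
  have hcs : ContinuousAt s x := by
    have hm := 𝒢.smooth_mul.continuousOn
      (h.localSection γ (𝒢.tgt (h.localSection δ x)), h.localSection δ x)
      (by
        change 𝒢.src (h.localSection γ (𝒢.tgt (h.localSection δ x))) =
          𝒢.tgt (h.localSection δ x)
        rw [hδx, ← hγδ, h.localSection_src])
    have : Tendsto (fun y => (h.localSection γ (𝒢.tgt (h.localSection δ y)), h.localSection δ y))
        (𝓝 x) (𝓝[{q : Γ × Γ | 𝒢.src q.1 = 𝒢.tgt q.2}]
          (h.localSection γ (𝒢.tgt (h.localSection δ x)), h.localSection δ x)) := by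
      refine tendsto_nhdsWithin_iff.2 ⟨hcγ.prodMk hcδ, ?_⟩
      filter_upwards [hdγ] with y hy
      exact h.src_localSection γ hy
    exact Tendsto.comp hm this
  have hsec : ∀ᶠ y in 𝓝 x, 𝒢.src (s y) = y := by
    filter_upwards [hdγ, hdδ] with y h1 h2
    rw [𝒢.src_mul _ _ (h.src_localSection γ h1), h.src_localSection δ h2]
  have key := h.eventuallyEq_localSection hcs hsec
  rw [hsx] at key
  have hproj := B.smooth_proj.continuous.continuousAt (x := p)
  filter_upwards [hproj.eventually key, hproj.eventually hdγ, hproj.eventually hdδ] with q h1 h2 h3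
  have hq : B.proj (B.gact (h.localSection δ (B.proj q)) q) =
      𝒢.tgt (h.localSection δ (B.proj q)) := B.proj_gact _ _ (h.src_localSection δ h3)
  simp only [Function.comp_apply, translate, hq, ← h1, s]
  exact (B.mul_gact _ _ _ (h.src_localSection γ h2) (h.src_localSection δ h3)).symm

theorem translate_act_eventuallyEq {γ : Γ} {p : P} (hp : 𝒢.src γ = B.proj p) (g : G) :
    (fun q => B.translate h γ (B.act q g)) =ᶠ[𝓝 p] fun q => B.act (B.translate h γ q) g := by
  filter_upwards [B.eventually_mem_sectionDomain h hp] with q hq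
  simp only [translate, B.proj_act]
  exact B.gact_act _ _ _ (h.src_localSection γ hq)

/-- On the tangent spaces of `Q`, the differential of the target map is given by `translate`. -/
theorem dTarget_apply (q : B.Q) (w : B.tangentQ q) :
    (B.dTarget q w : EP) =
      mfderiv 𝓘(ℝ, EP) 𝓘(ℝ, EP) (B.translate h q.1.1) q.1.2 (B.dSource q w) := by
  obtain ⟨⟨γ, p⟩, hp⟩ := q
  obtain ⟨w, hw⟩ := w
  have hp : 𝒢.src γ = B.proj p := hp
  -- `j` is a local section of the projection `Q → P` through `(γ, p)`, and `translate γ` is the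
  -- action composed with `j`. Since `j` takes values in `Q` near `p`, the chain rule applies to the
  -- derivative within `Q`.
  let j : P → Γ × P := fun r => (h.localSection γ (B.proj r), r)
  have hjp : j p = (γ, p) := by simp only [j, ← hp, h.localSection_src]
  have hsec : HasMFDerivAt 𝓘(ℝ, E₀) 𝓘(ℝ, E₁) (h.localSection γ) (B.proj p)
      (mfderiv 𝓘(ℝ, E₀) 𝓘(ℝ, E₁) (h.localSection γ) (B.proj p)) :=
    (hp ▸ (h.contMDiffAt_localSection γ).mdifferentiableAt (by simp)).hasMFDerivAt
  have hsrc : MDifferentiableAt 𝓘(ℝ, E₁) 𝓘(ℝ, E₀) 𝒢.src γ :=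
    (h.1 γ).mdifferentiableAt (by simp)
  have hproj : MDifferentiableAt 𝓘(ℝ, EP) 𝓘(ℝ, E₀) B.proj p :=
    B.smooth_proj.mdifferentiable (by simp) p
  have hj := (hsec.comp p hproj.hasMFDerivAt).prodMk (hasMFDerivAt_id p)
  have hg : HasMFDerivWithinAt (𝓘(ℝ, E₁).prod 𝓘(ℝ, EP)) 𝓘(ℝ, EP)
      (fun r : Γ × P => B.gact r.1 r.2) B.Q (j p)
      (mfderivWithin (𝓘(ℝ, E₁).prod 𝓘(ℝ, EP)) 𝓘(ℝ, EP)
        (fun r : Γ × P => B.gact r.1 r.2) B.Q (γ, p)) := by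
    rw [← hjp]
    refine (B.smooth_gact.mdifferentiableOn (by simp) (j p) ?_).hasMFDerivWithinAt
    rw [hjp]
    exact hp
  have hopen : B.proj ⁻¹' h.sectionDomain γ ∈ 𝓝 p := B.eventually_mem_sectionDomain h hp
  have hcomp := (hg.comp p (hj.hasMFDerivWithinAt (s := B.proj ⁻¹' h.sectionDomain γ))
    (fun r hr => h.src_localSection γ hr)).hasMFDerivAt hopen
  have hsnd : mfderiv (𝓘(ℝ, E₁).prod 𝓘(ℝ, EP)) 𝓘(ℝ, EP) (fun r : Γ × P => r.2) (γ, p) =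
      ContinuousLinearMap.snd ℝ E₁ EP := mfderiv_snd
  -- The section inverts the source map near `γ`; hence a vector of `T_q Q` is determined by its
  -- component along `P` and equals the image of that component under the differential of `j`.
  have hinv : ∀ x, x = 𝒢.src γ → ∀ u : E₁, (mfderiv 𝓘(ℝ, E₀) 𝓘(ℝ, E₁) (h.localSection γ) x
      (mfderiv 𝓘(ℝ, E₁) 𝓘(ℝ, E₀) 𝒢.src γ u : E₀) : E₁) = u := by
    rintro x rfl u
    have hs := ((h.contMDiffAt_localSection γ).mdifferentiableAt (by simp)).hasMFDerivAt.comp γ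
      hsrc.hasMFDerivAt
    have := hs.congr_of_eventuallyEq (f₁ := id)
      ((h.localSection_src_eventually γ).mono fun _ hy => hy.symm)
    exact congrArg (fun L : E₁ →L[ℝ] E₁ => L u) (hasMFDerivAt_unique this (hasMFDerivAt_id γ))
  change (mfderivWithin (𝓘(ℝ, E₁).prod 𝓘(ℝ, EP)) 𝓘(ℝ, EP)
        (fun r : Γ × P => B.gact r.1 r.2) B.Q (γ, p) w : EP) =
    mfderiv 𝓘(ℝ, EP) 𝓘(ℝ, EP) (B.translate h γ) p
      (mfderiv (𝓘(ℝ, E₁).prod 𝓘(ℝ, EP)) 𝓘(ℝ, EP) (fun r : Γ × P => r.2) (γ, p) w)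
  have heq : mfderiv 𝓘(ℝ, EP) 𝓘(ℝ, EP) (B.translate h γ) p = _ := hcomp.mfderiv
  rw [hsnd, heq]
  change _ = mfderivWithin (𝓘(ℝ, E₁).prod 𝓘(ℝ, EP)) 𝓘(ℝ, EP)
    (fun r : Γ × P => B.gact r.1 r.2) B.Q (γ, p)
      ((mfderiv 𝓘(ℝ, E₀) 𝓘(ℝ, E₁) (h.localSection γ) (B.proj p)
        (mfderiv 𝓘(ℝ, EP) 𝓘(ℝ, E₀) B.proj p w.2 : E₀) : E₁), w.2)
  have hw' : (mfderiv 𝓘(ℝ, E₁) 𝓘(ℝ, E₀) 𝒢.src γ w.1 : E₀) =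
    mfderiv 𝓘(ℝ, EP) 𝓘(ℝ, E₀) B.proj p w.2 := hw
  rw [← hw', hinv _ hp.symm]
  rfl

end GroupoidPrincipalBundle

/-! ### Flat connection forms and their cut-offs -/

/-- A smooth map into the tangent bundle of `G` that takes values in the tangent space at a
point `g` is smooth as a map into the model vector space. -/
theorem ContMDiffOn.snd_of_proj_eq {E F H N G : Type*}
    [NormedAddCommGroup E] [NormedSpace ℝ E] [TopologicalSpace H] {I : ModelWithCorners ℝ E H}
    [TopologicalSpace N] [ChartedSpace H N]
    [NormedAddCommGroup F] [NormedSpace ℝ F] [TopologicalSpace G] [ChartedSpace F G]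
    [IsManifold 𝓘(ℝ, F) ∞ G]
    {w : N → TangentBundle 𝓘(ℝ, F) G} {s : Set N} {g : G}
    (hw : ContMDiffOn I 𝓘(ℝ, F).tangent ∞ w s) (hg : ∀ x ∈ s, (w x).proj = g) :
    ContMDiffOn I 𝓘(ℝ, F) ∞ (fun x => ((w x).2 : F)) s := by
  intro x hx
  have h := ((Bundle.contMDiffWithinAt_totalSpace).1 (hw x hx)).2
  refine h.congr_of_mem ?_ hx
  intro y hy
  -- All base points equal `g`, so the trivialization at the base point of `w x` is the one at the
  -- base point of `w y`, where its coordinate change is the identity.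
  rw [hg x hx, ← hg y hy]
  exact ((tangentBundleCore 𝓘(ℝ, F) G).coordChange_self (achart F (w y).proj) (w y).proj
    (mem_chart_source F (w y).proj) (w y).2).symm

namespace SmoothPrincipalBundle

variable {E₀ M EG G EP P : Type*}
  [NormedAddCommGroup E₀] [NormedSpace ℝ E₀] [TopologicalSpace M] [ChartedSpace E₀ M]
  [NormedAddCommGroup EG] [NormedSpace ℝ EG] [TopologicalSpace G] [ChartedSpace EG G] [Group G]
  [NormedAddCommGroup EP] [NormedSpace ℝ EP] [TopologicalSpace P] [ChartedSpace EP P]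

/-- A form on `P` that satisfies the conditions of a connection form up to the weight `f`: it
sends the fundamental vector field of `X` to `f • X`. -/
structure IsWeightedConnectionForm [IsManifold 𝓘(ℝ, EP) ∞ P]
    (B : SmoothPrincipalBundle E₀ M EG G EP P) (f : M → ℝ)
    (θ : ∀ p : P, TangentSpace 𝓘(ℝ, EP) p →L[ℝ] GroupLieAlgebra 𝓘(ℝ, EG) G) : Prop where
  smooth_weight : ContMDiff 𝓘(ℝ, E₀) 𝓘(ℝ, ℝ) ∞ f
  smooth : ContMDiff 𝓘(ℝ, EP).tangent 𝓘(ℝ, EG) ∞ (M' := EG)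
    (fun v => θ v.proj v.2 : TangentBundle 𝓘(ℝ, EP) P → EG)
  apply_fundamental : ∀ (p : P) (X : GroupLieAlgebra 𝓘(ℝ, EG) G),
    θ p (B.fundamental p X) = f (B.proj p) • X
  equivariant : ∀ (p : P) (g : G) (v : TangentSpace 𝓘(ℝ, EP) p),
    θ (B.act p g) (mfderiv 𝓘(ℝ, EP) 𝓘(ℝ, EP) (fun r : P => B.act r g) p v) =
      lieAd EG g⁻¹ (θ p v)

/-- The flat connection form of a local trivialization. -/
def flatForm (B : SmoothPrincipalBundle E₀ M EG G EP P)
    (e : Bundle.Trivialization G B.proj) (p : P) :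
    TangentSpace 𝓘(ℝ, EP) p →L[ℝ] GroupLieAlgebra 𝓘(ℝ, EG) G :=
  (mfderiv 𝓘(ℝ, EP) 𝓘(ℝ, EG) (fun q : P => (e p).2⁻¹ * (e q).2) p : EP →L[ℝ] EG)

section

variable (B : SmoothPrincipalBundle E₀ M EG G EP P)
  {e : Bundle.Trivialization G B.proj}

theorem smooth_act_right (g : G) :
    ContMDiff 𝓘(ℝ, EP) 𝓘(ℝ, EP) ∞ (fun p : P => B.act p g) :=
  B.smooth_act.comp (contMDiff_id.prodMk contMDiff_const)

theorem smooth_orbit (p : P) : ContMDiff 𝓘(ℝ, EG) 𝓘(ℝ, EP) ∞ (fun g : G => B.act p g) :=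
  B.smooth_act.comp (contMDiff_const.prodMk contMDiff_id)

variable [LieGroup 𝓘(ℝ, EG) ∞ G]

/-- The point `p` occurs both as a parameter and as the point of differentiation. Separating the two
roles gives a map `Φ` on `P × P`; the form is its tangent map at the vectors `(0, v)` over the
diagonal, all of which land in the tangent space at `1`. -/
theorem contMDiffOn_flatForm [IsManifold 𝓘(ℝ, EP) ∞ P]
    (he : ContMDiffOn 𝓘(ℝ, EP) (𝓘(ℝ, E₀).prod 𝓘(ℝ, EG)) ∞ e e.source) :
    ContMDiffOn 𝓘(ℝ, EP).tangent 𝓘(ℝ, EG) ∞ (M' := EG)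
      (fun v : TangentBundle 𝓘(ℝ, EP) P => (B.flatForm e v.proj v.2 : EG))
      ((fun v : TangentBundle 𝓘(ℝ, EP) P => v.proj) ⁻¹' e.source) := by
  have hh : ContMDiffOn 𝓘(ℝ, EP) 𝓘(ℝ, EG) ∞ (fun q => (e q).2) e.source :=
    contMDiff_snd.comp_contMDiffOn he
  let Φ : P × P → G := fun q => (e q.1).2⁻¹ * (e q.2).2
  have hΦ : ContMDiffOn (𝓘(ℝ, EP).prod 𝓘(ℝ, EP)) 𝓘(ℝ, EG) ∞ Φ (e.source ×ˢ e.source) :=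
    ContMDiffOn.mul (hh.comp contMDiffOn_fst fun q hq => hq.1).inv
      (hh.comp contMDiffOn_snd fun q hq => hq.2)
  have hopen : IsOpen (e.source ×ˢ e.source) := e.open_source.prod e.open_source
  let z : TangentBundle 𝓘(ℝ, EP) P → TangentBundle (𝓘(ℝ, EP).prod 𝓘(ℝ, EP)) (P × P) := fun v =>
    (equivTangentBundleProd 𝓘(ℝ, EP) P 𝓘(ℝ, EP) P).symm
      (Bundle.zeroSection EP (TangentSpace 𝓘(ℝ, EP)) v.proj, v)
  have hz : ContMDiff 𝓘(ℝ, EP).tangent (𝓘(ℝ, EP).prod 𝓘(ℝ, EP)).tangent ∞ z := by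
    refine contMDiff_equivTangentBundleProd_symm.comp (ContMDiff.prodMk ?_ contMDiff_id)
    exact (Bundle.contMDiff_zeroSection ℝ (TangentSpace 𝓘(ℝ, EP) : P → Type _)).comp
      (Bundle.contMDiff_proj _)
  have hw := (hΦ.contMDiffOn_tangentMap_of_isOpen hopen).comp
    (s := (fun v : TangentBundle 𝓘(ℝ, EP) P => v.proj) ⁻¹' e.source)
    hz.contMDiffOn fun v hv => (⟨hv, hv⟩ : (v.proj, v.proj) ∈ e.source ×ˢ e.source)
  have h2 := hw.snd_of_proj_eq (G := G) (g := 1) (fun v _ => inv_mul_cancel _)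
  refine h2.congr fun v hv => ?_
  have hd : MDifferentiableAt (𝓘(ℝ, EP).prod 𝓘(ℝ, EP)) 𝓘(ℝ, EG) Φ (v.proj, v.proj) :=
    (hΦ.contMDiffAt (hopen.mem_nhds (Set.mk_mem_prod hv hv))).mdifferentiableAt (by simp)
  have hc := hd.hasMFDerivAt.comp v.proj
    ((hasMFDerivAt_const v.proj v.proj).prodMk (hasMFDerivAt_id v.proj))
  exact congrArg (fun L : EP →L[ℝ] EG => L v.2) hc.mfderiv

theorem mdifferentiableAt_snd_trivialization
    (he : ContMDiffOn 𝓘(ℝ, EP) (𝓘(ℝ, E₀).prod 𝓘(ℝ, EG)) ∞ e e.source)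
    {p : P} (hp : p ∈ e.source) (g : G) :
    MDifferentiableAt 𝓘(ℝ, EP) 𝓘(ℝ, EG) (fun q => g * (e q).2) p := by
  have hh : ContMDiffOn 𝓘(ℝ, EP) 𝓘(ℝ, EG) ∞ (fun q => (e q).2) e.source :=
    contMDiff_snd.comp_contMDiffOn he
  exact ((contMDiffOn_const.mul hh).contMDiffAt
    (e.open_source.mem_nhds hp)).mdifferentiableAt (by simp)

/-- Along the orbit `g ↦ p · g`, the function differentiated in `flatForm` is the identity of `G`.
-/
theorem flatForm_fundamental
    (he : ContMDiffOn 𝓘(ℝ, EP) (𝓘(ℝ, E₀).prod 𝓘(ℝ, EG)) ∞ e e.source)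
    (hact : ∀ p ∈ e.source, ∀ g : G, e (B.act p g) = ((e p).1, (e p).2 * g))
    {p : P} (hp : p ∈ e.source) (X : GroupLieAlgebra 𝓘(ℝ, EG) G) :
    B.flatForm e p (B.fundamental p X) = X := by
  have h1 : HasMFDerivAt 𝓘(ℝ, EP) 𝓘(ℝ, EG) (fun q => (e p).2⁻¹ * (e q).2) (B.act p 1)
      (B.flatForm e p : EP →L[ℝ] EG) := by
    rw [B.act_one]
    exact (mdifferentiableAt_snd_trivialization B he hp _).hasMFDerivAt
  have h2 := h1.comp (1 : G) ((B.smooth_orbit p).mdifferentiable (by simp) 1).hasMFDerivAt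
  have h3 := h2.congr_of_eventuallyEq (f₁ := id) (Filter.Eventually.of_forall fun g => by
    simp [hact p hp g])
  exact congrArg (fun L : EG →L[ℝ] EG => L X) (hasMFDerivAt_unique h3 (hasMFDerivAt_id (1 : G)))

/-- With `k q = (e q).2`, equivariance of `e` gives `k (p · g)⁻¹ * k (q · g) = g⁻¹ * (k p⁻¹ * k q) *
g`; differentiate at `q = p`. -/
theorem flatForm_equivariant
    (he : ContMDiffOn 𝓘(ℝ, EP) (𝓘(ℝ, E₀).prod 𝓘(ℝ, EG)) ∞ e e.source)
    (hact : ∀ p ∈ e.source, ∀ g : G, e (B.act p g) = ((e p).1, (e p).2 * g))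
    {p : P} (hp : p ∈ e.source) (g : G) (v : TangentSpace 𝓘(ℝ, EP) p) :
    B.flatForm e (B.act p g) (mfderiv 𝓘(ℝ, EP) 𝓘(ℝ, EP) (fun r : P => B.act r g) p v) =
      lieAd EG g⁻¹ (B.flatForm e p v) := by
  have hpg : B.act p g ∈ e.source := by
    rw [e.mem_source, B.proj_act]
    exact e.mem_source.1 hp
  have h1 := (mdifferentiableAt_snd_trivialization B he hpg (e (B.act p g)).2⁻¹).hasMFDerivAt.comp p
    ((B.smooth_act_right g).mdifferentiable (by simp) p).hasMFDerivAt
  have hconj : HasMFDerivAt 𝓘(ℝ, EG) 𝓘(ℝ, EG) (fun h : G => g⁻¹ * h * g⁻¹⁻¹) ((e p).2⁻¹ * (e p).2)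
      (lieAd EG g⁻¹ : EG →L[ℝ] EG) := by
    rw [inv_mul_cancel]
    have : ContMDiff 𝓘(ℝ, EG) 𝓘(ℝ, EG) ∞ (fun h : G => g⁻¹ * h * g⁻¹⁻¹) :=
      (contMDiff_const.mul contMDiff_id).mul contMDiff_const
    exact (this.mdifferentiable (by simp) 1).hasMFDerivAt
  have h2 := hconj.comp p (mdifferentiableAt_snd_trivialization B he hp (e p).2⁻¹).hasMFDerivAt
  have h3 := h2.congr_of_eventuallyEq
    (f₁ := (fun q => (e (B.act p g)).2⁻¹ * (e q).2) ∘ fun r => B.act r g) (by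
      filter_upwards [e.open_source.mem_nhds hp] with q hq
      simp [hact p hp g, hact q hq g, mul_assoc])
  exact congrArg (fun L : EP →L[ℝ] EG => L v) (hasMFDerivAt_unique h1 h3)

variable [FiniteDimensional ℝ E₀] [IsManifold 𝓘(ℝ, E₀) ∞ M] [T2Space M] [IsManifold 𝓘(ℝ, EP) ∞ P]

/-- Around every point there is a compactly supported weighted connection form. -/
theorem exists_isWeightedConnectionForm (x : M) :
    ∃ (f : M → ℝ) (θ : ∀ p : P, TangentSpace 𝓘(ℝ, EP) p →L[ℝ] GroupLieAlgebra 𝓘(ℝ, EG) G),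
      B.IsWeightedConnectionForm f θ ∧ (∀ y, 0 ≤ f y) ∧ 0 < f x ∧ HasCompactSupport f ∧
      ∀ p, B.proj p ∉ tsupport f → θ p = 0 := by
  obtain ⟨e, hx, he, -, hact⟩ := B.locally_trivial x
  obtain ⟨ρ, -, hρ⟩ := (SmoothBumpFunction.nhds_basis_tsupport (I := 𝓘(ℝ, E₀)) x).mem_iff.1
    (e.open_baseSet.mem_nhds hx)
  -- The factor `ρ` makes the values of `flatForm` outside the domain of the trivialization
  -- irrelevant.
  have hzero : ∀ p, p ∉ e.source → ρ (B.proj p) = 0 := fun p hp => by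
    by_contra hne
    exact hp (e.mem_source.2 (hρ (subset_tsupport _ hne)))
  refine ⟨ρ, fun p => ρ (B.proj p) • B.flatForm e p, ⟨ρ.contMDiff, ?_, ?_, ?_⟩,
    fun y => ρ.nonneg, by rw [ρ.eq_one]; exact one_pos, ρ.hasCompactSupport, ?_⟩
  · intro v
    have hproj : Continuous fun v : TangentBundle 𝓘(ℝ, EP) P => B.proj v.proj :=
      B.smooth_proj.continuous.comp (FiberBundle.continuous_proj EP _)
    by_cases hv : B.proj v.proj ∈ e.baseSet
    · have hopen : IsOpen ((fun v : TangentBundle 𝓘(ℝ, EP) P => v.proj) ⁻¹' e.source) :=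
        e.open_source.preimage (FiberBundle.continuous_proj EP _)
      have h1 := (B.contMDiffOn_flatForm he).contMDiffAt (hopen.mem_nhds (e.mem_source.2 hv))
      have h2 : ContMDiff 𝓘(ℝ, EP).tangent 𝓘(ℝ, ℝ) ∞
          (fun v : TangentBundle 𝓘(ℝ, EP) P => ρ (B.proj v.proj)) :=
        ρ.contMDiff.comp (B.smooth_proj.comp (Bundle.contMDiff_proj _))
      have h3 := h2.contMDiffAt.smul (M := EG) h1
      exact h3
    -- The closed support of `ρ` lies in the base set, so a point outside the base set has a
    -- neighbourhood on which the product vanishes.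
    · have hmem : (fun v : TangentBundle 𝓘(ℝ, EP) P => B.proj v.proj) ⁻¹' (tsupport ρ)ᶜ ∈ 𝓝 v :=
        ((isClosed_tsupport _).isOpen_compl.preimage hproj).mem_nhds fun h => hv (hρ h)
      refine (contMDiffAt_const (c := (0 : EG))).congr_of_eventuallyEq ?_
      filter_upwards [hmem] with w hw
      have : ρ (B.proj w.proj) = 0 := image_eq_zero_of_notMem_tsupport hw
      simp only [this, zero_smul]
      rfl
  · intro p X
    by_cases hp : p ∈ e.source
    · exact congrArg (fun Y : EG => ρ (B.proj p) • Y) (B.flatForm_fundamental he hact hp X)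
    · simp only [hzero p hp, zero_smul]
      rfl
  · intro p g v
    by_cases hp : p ∈ e.source
    · rw [B.proj_act]
      exact (congrArg (fun Y : EG => ρ (B.proj p) • Y)
        (B.flatForm_equivariant he hact hp g v)).trans
          ((lieAd EG g⁻¹).map_smul (ρ (B.proj p)) (B.flatForm e p v)).symm
    · simp only [B.proj_act, hzero p hp, zero_smul]
      exact ((lieAd EG g⁻¹).map_zero).symm
  · intro p hp
    have : ρ (B.proj p) = 0 := image_eq_zero_of_notMem_tsupport hp
    simp only [this, zero_smul]

end

end SmoothPrincipalBundle

/-! ### Finite sums over the source fibres of a proper étale groupoid -/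

namespace LieGroupoid

variable {E₀ M E₁ Γ : Type*}
  [NormedAddCommGroup E₀] [NormedSpace ℝ E₀] [TopologicalSpace M] [ChartedSpace E₀ M]
  [NormedAddCommGroup E₁] [NormedSpace ℝ E₁] [TopologicalSpace Γ] [ChartedSpace E₁ Γ]
  {𝒢 : LieGroupoid E₀ M E₁ Γ}

/-- In a proper étale groupoid, the arrows with target in a given compact set and source near `x₀`
form finitely many disjoint local sections of the source map. -/
theorem IsEtale.exists_finset_localSection (h : 𝒢.IsEtale) (hpr : 𝒢.IsProper)
    [LocallyCompactSpace M] [T2Space M] [T2Space Γ] {K : Set M} (hK : IsCompact K) (x₀ : M) :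
    ∃ T : Finset Γ, (∀ γ ∈ T, 𝒢.src γ = x₀) ∧ ∀ᶠ x in 𝓝 x₀,
      (∀ γ ∈ T, x ∈ h.sectionDomain γ) ∧
      InjOn (fun γ => h.localSection γ x) (T : Set Γ) ∧
      ∀ γ, 𝒢.src γ = x → 𝒢.tgt γ ∈ K → ∃ γ₀ ∈ T, h.localSection γ₀ x = γ := by
  have hcs : Continuous 𝒢.src := h.1.contMDiff.continuous
  have hct : Continuous 𝒢.tgt := h.2.contMDiff.continuous
  have hcomp : ∀ L : Set M, IsCompact L → IsCompact {γ | 𝒢.tgt γ ∈ K ∧ 𝒢.src γ ∈ L} :=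
    fun L hL => hpr.isCompact_preimage (hK.prod hL)
  have hS := hcomp {x₀} isCompact_singleton
  -- The arrows from `x₀` into `K` form a compact set by properness. It is covered by finitely many
  -- open sets, on each of which one local section recovers every arrow from its source.
  obtain ⟨T, hTS, hcov⟩ := hS.elim_nhds_subcover
    (fun γ => interior {γ' | h.localSection γ (𝒢.src γ') = γ'})
    (fun γ _ => interior_mem_nhds.2 (h.localSection_src_eventually γ))
  refine ⟨T, fun γ hγ => (hTS γ hγ).2, ?_⟩
  have h1 : ∀ᶠ x in 𝓝 x₀, ∀ γ ∈ T, x ∈ h.sectionDomain γ := by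
    refine (Filter.eventually_all_finset T).2 fun γ hγ => ?_
    have hx : 𝒢.src γ = x₀ := (hTS γ hγ).2
    exact hx ▸ h.sectionDomain_mem_nhds γ
  -- At `x₀` the sections take the distinct values `γ ∈ T`; as `Γ` is Hausdorff, finitely many
  -- distinct values stay distinct nearby.
  have h2 : ∀ᶠ x in 𝓝 x₀, InjOn (fun γ => h.localSection γ x) (T : Set Γ) := by
    have : ∀ᶠ x in 𝓝 x₀, ∀ γ ∈ T, ∀ γ' ∈ T, γ ≠ γ' →
        h.localSection γ x ≠ h.localSection γ' x := by
      refine (Filter.eventually_all_finset T).2 fun γ hγ =>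
        (Filter.eventually_all_finset T).2 fun γ' hγ' => ?_
      by_cases hne : γ = γ'
      · exact Filter.Eventually.of_forall fun x hx => absurd hne hx
      have hx : 𝒢.src γ = x₀ := (hTS γ hγ).2
      have hx' : 𝒢.src γ' = x₀ := (hTS γ' hγ').2
      have c : ContinuousAt (h.localSection γ) x₀ :=
        hx ▸ (h.contMDiffAt_localSection γ).continuousAt
      have c' : ContinuousAt (h.localSection γ') x₀ :=
        hx' ▸ (h.contMDiffAt_localSection γ').continuousAt
      have hne' : h.localSection γ x₀ ≠ h.localSection γ' x₀ := by
        rw [← hx, h.localSection_src, hx, ← hx', h.localSection_src]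
        exact hne
      exact ((c.prodMk c').eventually (isClosed_diagonal.isOpen_compl.mem_nhds hne')).mono
        fun x hx _ => hx
    filter_upwards [this] with x hx γ hγ γ' hγ' heq
    by_contra hne
    exact hx γ hγ γ' hγ' hne heq
  have h3 : ∀ᶠ x in 𝓝 x₀, ∀ γ, 𝒢.src γ = x → 𝒢.tgt γ ∈ K →
      ∃ γ₀ ∈ T, h.localSection γ₀ x = γ := by
    obtain ⟨L, hL, hLx⟩ := exists_compact_mem_nhds x₀
    have hopen : IsOpen (⋃ γ ∈ T, interior {γ' | h.localSection γ (𝒢.src γ') = γ'}) :=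
      isOpen_biUnion fun _ _ => isOpen_interior
    -- The arrows into `K` from `L` that escape the cover form a compact set. Its image under the
    -- source map is closed and misses `x₀`, so it misses a neighbourhood of `x₀`.
    have hC := (((hcomp L hL).diff hopen).image hcs).isClosed
    have hx : x₀ ∉ 𝒢.src '' ({γ | 𝒢.tgt γ ∈ K ∧ 𝒢.src γ ∈ L} \
        ⋃ γ ∈ T, interior {γ' | h.localSection γ (𝒢.src γ') = γ'}) := by
      rintro ⟨γ, ⟨⟨hγK, -⟩, hγ⟩, hγx⟩
      exact hγ (hcov ⟨hγK, hγx⟩)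
    filter_upwards [hLx, hC.isOpen_compl.mem_nhds hx] with x hxL hxC γ hγ hγK
    by_contra hcon
    refine hxC ⟨γ, ⟨⟨hγK, by rwa [hγ]⟩, fun hmem => hcon ?_⟩, hγ⟩
    obtain ⟨γ₀, hγ₀, hmem⟩ := mem_iUnion₂.1 hmem
    refine ⟨γ₀, hγ₀, ?_⟩
    have := interior_subset hmem
    rwa [mem_ofPred_eq, hγ] at this
  filter_upwards [h1, h2, h3] with x a b c using ⟨a, b, c⟩

/-- The values of the sections in `T` are distinct arrows of the fibre and include all those with
target in `K`; on all other arrows of the fibre `F` vanishes. -/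
theorem IsEtale.finsum_src_fiber (h : 𝒢.IsEtale) {V : Type*} [AddCommMonoid V] {K : Set M} {x : M}
    {T : Finset Γ} (hT : (∀ γ ∈ T, x ∈ h.sectionDomain γ) ∧
      InjOn (fun γ => h.localSection γ x) (T : Set Γ) ∧
      ∀ γ, 𝒢.src γ = x → 𝒢.tgt γ ∈ K → ∃ γ₀ ∈ T, h.localSection γ₀ x = γ)
    {F : Γ → V} (hF : ∀ γ, 𝒢.src γ = x → 𝒢.tgt γ ∉ K → F γ = 0) :
    ∑ᶠ γ ∈ {γ | 𝒢.src γ = x}, F γ = ∑ γ ∈ T, F (h.localSection γ x) := by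
  rw [← finsum_mem_coe_finset, ← finsum_mem_image (f := F) hT.2.1]
  refine finsum_mem_inter_support_eq F _ _ ?_
  ext γ
  constructor
  · rintro ⟨hγ, hsupp⟩
    refine ⟨?_, hsupp⟩
    obtain ⟨γ₀, h₀, heq⟩ := hT.2.2 γ hγ (by_contra fun hK => hsupp (hF γ hγ hK))
    exact ⟨γ₀, h₀, heq⟩
  · rintro ⟨⟨γ₀, h₀, rfl⟩, hsupp⟩
    exact ⟨h.src_localSection γ₀ (hT.1 γ₀ h₀), hsupp⟩

/-- Right multiplication by an arrow `δ` is a bijection between source fibres. -/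
theorem bijOn_mul_right (𝒢 : LieGroupoid E₀ M E₁ Γ) (δ : Γ) :
    BijOn (fun γ => 𝒢.mul γ δ) {γ | 𝒢.src γ = 𝒢.tgt δ} {γ | 𝒢.src γ = 𝒢.src δ} := by
  have hinv : ∀ γ, 𝒢.src γ = 𝒢.tgt δ → 𝒢.mul (𝒢.mul γ δ) (𝒢.inv δ) = γ := fun γ hγ => by
    rw [𝒢.mul_assoc _ _ _ hγ (𝒢.tgt_inv δ).symm, 𝒢.mul_inv, ← hγ, 𝒢.mul_one]
  refine ⟨fun γ hγ => 𝒢.src_mul _ _ hγ, fun γ hγ γ' hγ' heq => ?_, fun γ hγ => ?_⟩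
  · rw [← hinv γ hγ, ← hinv γ' hγ']
    exact congrArg (fun η => 𝒢.mul η (𝒢.inv δ)) heq
  · have hγ : 𝒢.src γ = 𝒢.src δ := hγ
    refine ⟨𝒢.mul γ (𝒢.inv δ), ?_, ?_⟩
    · exact (𝒢.src_mul _ _ (hγ.trans (𝒢.tgt_inv δ).symm)).trans (𝒢.src_inv δ)
    · change 𝒢.mul (𝒢.mul γ (𝒢.inv δ)) δ = γ
      rw [𝒢.mul_assoc _ _ _ (hγ.trans (𝒢.tgt_inv δ).symm) (𝒢.src_inv δ), 𝒢.inv_mul, ← hγ,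
        𝒢.mul_one]

/-- The sum of a function on the units over the targets of the arrows with a given source. -/
def fiberSum (𝒢 : LieGroupoid E₀ M E₁ Γ) (f : M → ℝ) (x : M) : ℝ :=
  ∑ᶠ γ ∈ {γ | 𝒢.src γ = x}, f (𝒢.tgt γ)

/-- Reindexing by `γ ↦ mul γ δ` does not change the targets. -/
theorem fiberSum_tgt (𝒢 : LieGroupoid E₀ M E₁ Γ) (f : M → ℝ) (δ : Γ) :
    𝒢.fiberSum f (𝒢.tgt δ) = 𝒢.fiberSum f (𝒢.src δ) :=
  finsum_mem_eq_of_bijOn _ (𝒢.bijOn_mul_right δ) fun γ hγ => by rw [𝒢.tgt_mul γ δ hγ]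

theorem fiberSum_nonneg (𝒢 : LieGroupoid E₀ M E₁ Γ) {f : M → ℝ} (hf : ∀ y, 0 ≤ f y) (x : M) :
    0 ≤ 𝒢.fiberSum f x :=
  finsum_mem_induction (0 ≤ ·) le_rfl (fun _ _ => add_nonneg) fun _ _ => hf _

section

variable [LocallyCompactSpace M] [T2Space M] [T2Space Γ] {f : M → ℝ}

/-- The unit arrow at `x` contributes `f x`. The sum is genuinely finite by properness, so the
default value `0` of `finsum` does not occur. -/
theorem IsEtale.fiberSum_pos (h : 𝒢.IsEtale) (hpr : 𝒢.IsProper) (hf : HasCompactSupport f)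
    (h0 : ∀ y, 0 ≤ f y) {x : M} (hx : 0 < f x) : 0 < 𝒢.fiberSum f x := by
  obtain ⟨T, hT, hev⟩ := h.exists_finset_localSection hpr hf x
  have hzero : ∀ γ, 𝒢.src γ = x → 𝒢.tgt γ ∉ tsupport f → f (𝒢.tgt γ) = 0 :=
    fun γ _ hγ => image_eq_zero_of_notMem_tsupport hγ
  rw [fiberSum, h.finsum_src_fiber hev.self_of_nhds hzero]
  obtain ⟨γ₀, h₀, heq⟩ := hev.self_of_nhds.2.2 (𝒢.one x) (𝒢.src_one x)
    (by rw [𝒢.tgt_one]; exact subset_tsupport f hx.ne')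
  refine Finset.sum_pos' (fun γ _ => h0 _) ⟨γ₀, h₀, ?_⟩
  rwa [heq, 𝒢.tgt_one]

theorem IsEtale.contMDiff_fiberSum (h : 𝒢.IsEtale) (hpr : 𝒢.IsProper) (hf : HasCompactSupport f)
    (hs : ContMDiff 𝓘(ℝ, E₀) 𝓘(ℝ, ℝ) ∞ f) :
    ContMDiff 𝓘(ℝ, E₀) 𝓘(ℝ, ℝ) ∞ (𝒢.fiberSum f) := by
  intro x
  obtain ⟨T, hT, hev⟩ := h.exists_finset_localSection hpr hf x
  have hsum : ContMDiffAt 𝓘(ℝ, E₀) 𝓘(ℝ, ℝ) ∞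
      (fun y => ∑ γ ∈ T, f (𝒢.tgt (h.localSection γ y))) x := by
    refine contMDiffAt_finsetSum fun γ hγ => ?_
    have hsec := h.contMDiffAt_localSection γ
    rw [hT γ hγ] at hsec
    exact (hs.comp h.2.contMDiff).contMDiffAt.comp x hsec
  refine hsum.congr_of_eventuallyEq ?_
  filter_upwards [hev] with y hy
  exact h.finsum_src_fiber hy fun γ _ hγ => image_eq_zero_of_notMem_tsupport hγ

end

end LieGroupoid

/-! ### Summing the pull-backs of a form over all arrows -/

namespace GroupoidPrincipalBundle

open LieGroupoid

variable {E₀ M E₁ Γ EG G EP P : Type*}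
  [NormedAddCommGroup E₀] [NormedSpace ℝ E₀] [TopologicalSpace M] [ChartedSpace E₀ M]
  [NormedAddCommGroup E₁] [NormedSpace ℝ E₁] [TopologicalSpace Γ] [ChartedSpace E₁ Γ]
  [NormedAddCommGroup EG] [NormedSpace ℝ EG] [TopologicalSpace G] [ChartedSpace EG G] [Group G]
  [NormedAddCommGroup EP] [NormedSpace ℝ EP] [TopologicalSpace P] [ChartedSpace EP P]
  {𝒢 : LieGroupoid E₀ M E₁ Γ} (B : GroupoidPrincipalBundle 𝒢 EG G EP P) (h : 𝒢.IsEtale)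

/-- The differential of `translate γ` as a map of the model vector space. -/
def dTranslate (γ : Γ) (p : P) : EP →L[ℝ] EP :=
  mfderiv 𝓘(ℝ, EP) 𝓘(ℝ, EP) (B.translate h γ) p

/-- The differential of the right translation by `g` as a map of the model vector space. -/
def dRight (g : G) (p : P) : EP →L[ℝ] EP :=
  mfderiv 𝓘(ℝ, EP) 𝓘(ℝ, EP) (fun r : P => B.act r g) p

variable {h}

theorem hasMFDerivAt_translate {γ : Γ} {p : P} (hp : 𝒢.src γ = B.proj p) :
    HasMFDerivAt 𝓘(ℝ, EP) 𝓘(ℝ, EP) (B.translate h γ) p (B.dTranslate h γ p) :=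
  (B.mdifferentiableAt_translate h hp).hasMFDerivAt

theorem hasMFDerivAt_act_right (g : G) (p : P) :
    HasMFDerivAt 𝓘(ℝ, EP) 𝓘(ℝ, EP) (fun r : P => B.act r g) p (B.dRight g p) :=
  ((B.smooth_act_right g).mdifferentiable (by simp) p).hasMFDerivAt

/-- When `p` varies, the arrow `localSection γ (proj p)` varies too; this replaces its translation
by that of the fixed arrow `γ`, as needed for smoothness in `p`. -/
theorem dTranslate_localSection {γ : Γ} {p : P} (hp : B.proj p ∈ h.sectionDomain γ) :
    B.dTranslate h (h.localSection γ (B.proj p)) p = B.dTranslate h γ p :=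
  (B.translate_localSection_eventuallyEq h hp).mfderiv_eq

theorem dTranslate_mul {γ δ : Γ} {p : P} (hγδ : 𝒢.src γ = 𝒢.tgt δ) (hp : 𝒢.src δ = B.proj p) :
    B.dTranslate h (𝒢.mul γ δ) p = B.dTranslate h γ (B.gact δ p) ∘L B.dTranslate h δ p := by
  have h1 : HasMFDerivAt 𝓘(ℝ, EP) 𝓘(ℝ, EP) (B.translate h γ) (B.translate h δ p)
      (B.dTranslate h γ (B.gact δ p)) := by
    rw [B.translate_apply h hp]
    exact B.hasMFDerivAt_translate (hγδ.trans (B.proj_gact δ p hp).symm)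
  have h2 := (h1.comp p (B.hasMFDerivAt_translate hp)).congr_of_eventuallyEq
    (B.translate_mul_eventuallyEq h hγδ hp).symm
  exact hasMFDerivAt_unique (B.hasMFDerivAt_translate ((𝒢.src_mul γ δ hγδ).trans hp)) h2

theorem dTranslate_dRight {γ : Γ} {p : P} (hp : 𝒢.src γ = B.proj p) (g : G) :
    B.dTranslate h γ (B.act p g) ∘L B.dRight g p =
      B.dRight g (B.gact γ p) ∘L B.dTranslate h γ p := by
  have h1 := (B.hasMFDerivAt_translate (h := h) (hp.trans (B.proj_act p g).symm)).comp p
    (B.hasMFDerivAt_act_right g p)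
  have h2 : HasMFDerivAt 𝓘(ℝ, EP) 𝓘(ℝ, EP) (fun r : P => B.act r g) (B.translate h γ p)
      (B.dRight g (B.gact γ p)) := by
    rw [B.translate_apply h hp]
    exact B.hasMFDerivAt_act_right g _
  have h3 := (h2.comp p (B.hasMFDerivAt_translate hp)).congr_of_eventuallyEq
    (B.translate_act_eventuallyEq h hp g)
  exact hasMFDerivAt_unique h1 h3

theorem dTranslate_fundamental {γ : Γ} {p : P} (hp : 𝒢.src γ = B.proj p)
    (X : GroupLieAlgebra 𝓘(ℝ, EG) G) :
    B.dTranslate h γ p (B.fundamental p X) = B.fundamental (B.gact γ p) X := by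
  have h1 : HasMFDerivAt 𝓘(ℝ, EP) 𝓘(ℝ, EP) (B.translate h γ) (B.act p 1)
      (B.dTranslate h γ p) := by
    rw [B.act_one]
    exact B.hasMFDerivAt_translate hp
  have h2 := h1.comp (1 : G) ((B.smooth_orbit p).mdifferentiable (by simp) 1).hasMFDerivAt
  have h3 := ((B.smooth_orbit (B.gact γ p)).mdifferentiable (by simp) 1).hasMFDerivAt
  have h4 := h3.congr_of_eventuallyEq (f₁ := B.translate h γ ∘ fun g => B.act p g)
    (Filter.Eventually.of_forall fun g => by
      rw [Function.comp_apply, B.translate_apply h (hp.trans (B.proj_act p g).symm)]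
      exact B.gact_act γ p g hp)
  exact congrArg (fun L : EG →L[ℝ] EP => L X) (hasMFDerivAt_unique h2 h4)

variable (h) in
/-- The pull-back of a form on `P`, with values taken in the model vector spaces, by `γ`. -/
def pullback (η : P → EP →L[ℝ] EG) (γ : Γ) (p : P) : EP →L[ℝ] EG :=
  η (B.gact γ p) ∘L B.dTranslate h γ p

variable (h) in
/-- The sum of the pull-backs of a form on `P` by all arrows. -/
def formSum (η : P → EP →L[ℝ] EG) (p : P) : EP →L[ℝ] EG :=
  ∑ᶠ γ ∈ {γ | 𝒢.src γ = B.proj p}, B.pullback h η γ p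

theorem pullback_eq_zero {η : P → EP →L[ℝ] EG} {K : Set M} (hη : ∀ p, B.proj p ∉ K → η p = 0)
    {γ : Γ} {p : P} (hp : 𝒢.src γ = B.proj p) (hγ : 𝒢.tgt γ ∉ K) : B.pullback h η γ p = 0 := by
  rw [pullback, hη _ (by rwa [B.proj_gact γ p hp]), ContinuousLinearMap.zero_comp]

section

variable {K : Set M} {η : P → EP →L[ℝ] EG}

theorem formSum_apply_eq_sum (hη : ∀ p, B.proj p ∉ K → η p = 0) {p : P} {T : Finset Γ}
    (hT : (∀ γ ∈ T, B.proj p ∈ h.sectionDomain γ) ∧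
      InjOn (fun γ => h.localSection γ (B.proj p)) (T : Set Γ) ∧
      ∀ γ, 𝒢.src γ = B.proj p → 𝒢.tgt γ ∈ K → ∃ γ₀ ∈ T, h.localSection γ₀ (B.proj p) = γ)
    (v : EP) :
    B.formSum h η p v = ∑ γ ∈ T, B.pullback h η (h.localSection γ (B.proj p)) p v := by
  rw [formSum, h.finsum_src_fiber hT
      (F := fun γ => B.pullback h η γ p) fun γ hp hγ => B.pullback_eq_zero hη hp hγ,
    sum_apply]

variable [LocallyCompactSpace M] [T2Space M] [T2Space Γ]

/-- Evaluation at `v` commutes with the sum because properness leaves finitely many nonzero terms.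
-/
theorem formSum_apply (hpr : 𝒢.IsProper) (hK : IsCompact K) (hη : ∀ p, B.proj p ∉ K → η p = 0)
    (p : P) (v : EP) :
    B.formSum h η p v = ∑ᶠ γ ∈ {γ | 𝒢.src γ = B.proj p}, B.pullback h η γ p v := by
  obtain ⟨T, -, hev⟩ := h.exists_finset_localSection hpr hK (B.proj p)
  rw [B.formSum_apply_eq_sum hη hev.self_of_nhds,
    h.finsum_src_fiber hev.self_of_nhds (F := fun γ => B.pullback h η γ p v)
      fun γ hp hγ => by rw [B.pullback_eq_zero hη hp hγ, zero_apply]]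

/-- Pulling back by `γ` and then by `δ` is pulling back by `mul γ δ`, and right multiplication by
`δ` is a bijection between the source fibres. -/
theorem formSum_dTranslate (hpr : 𝒢.IsProper) (hK : IsCompact K)
    (hη : ∀ p, B.proj p ∉ K → η p = 0) {δ : Γ} {p : P} (hp : 𝒢.src δ = B.proj p) (v : EP) :
    B.formSum h η (B.gact δ p) (B.dTranslate h δ p v) = B.formSum h η p v := by
  rw [B.formSum_apply hpr hK hη, B.formSum_apply hpr hK hη, B.proj_gact δ p hp, ← hp]
  refine finsum_mem_eq_of_bijOn _ (𝒢.bijOn_mul_right δ) fun γ hγ => ?_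
  rw [pullback, pullback, B.mul_gact γ δ p hγ hp, B.dTranslate_mul hγ hp]
  rfl

theorem contMDiff_formSum [IsManifold 𝓘(ℝ, EP) ∞ P] (hpr : 𝒢.IsProper) (hK : IsCompact K)
    (hη : ∀ p, B.proj p ∉ K → η p = 0)
    (hs : ContMDiff 𝓘(ℝ, EP).tangent 𝓘(ℝ, EG) ∞
      (fun v : TangentBundle 𝓘(ℝ, EP) P => η v.proj (v.2 : EP))) :
    ContMDiff 𝓘(ℝ, EP).tangent 𝓘(ℝ, EG) ∞
      (fun v : TangentBundle 𝓘(ℝ, EP) P => B.formSum h η v.proj (v.2 : EP)) := by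
  intro v₀
  obtain ⟨T, -, hev⟩ := h.exists_finset_localSection hpr hK (B.proj v₀.proj)
  have hcont : Continuous fun v : TangentBundle 𝓘(ℝ, EP) P => B.proj v.proj :=
    B.smooth_proj.continuous.comp (FiberBundle.continuous_proj EP _)
  have hsm : ContMDiffAt 𝓘(ℝ, EP).tangent 𝓘(ℝ, EG) ∞
      (fun v : TangentBundle 𝓘(ℝ, EP) P => ∑ γ ∈ T,
        η (B.translate h γ v.proj) (B.dTranslate h γ v.proj (v.2 : EP))) v₀ := by
    refine contMDiffAt_finsetSum fun γ hγ => ?_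
    have hopen := B.isOpen_proj_preimage (h.isOpen_sectionDomain γ)
    have htan := ((B.contMDiffOn_translate h γ).contMDiffOn_tangentMap_of_isOpen
      hopen).contMDiffAt ((hopen.preimage (FiberBundle.continuous_proj EP _)).mem_nhds
        (x := v₀) (hev.self_of_nhds.1 γ hγ))
    -- Each term is the form, as a function on the tangent bundle, composed with the tangent map of
    -- a translation.
    exact hs.contMDiffAt.comp v₀ htan
  refine hsm.congr_of_eventuallyEq ?_
  filter_upwards [hcont.continuousAt.eventually hev] with v hv
  refine (B.formSum_apply_eq_sum hη hv (v.2 : EP)).trans (Finset.sum_congr rfl fun γ hγ => ?_)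
  rw [pullback, B.dTranslate_localSection (hv.1 γ hγ)]
  rfl

/-- Translations carry fundamental vectors to fundamental vectors, so each arrow `γ` contributes `f
(tgt γ) • X`. -/
theorem formSum_fundamental (hpr : 𝒢.IsProper) {f : M → ℝ} (hf : HasCompactSupport f)
    (hη : ∀ p, B.proj p ∉ tsupport f → η p = 0)
    (hfund : ∀ (p : P) (X : EG), η p (B.fundamental p X : EP) = f (B.proj p) • X)
    (p : P) (X : EG) :
    B.formSum h η p (B.fundamental p X : EP) = 𝒢.fiberSum f (B.proj p) • X := by
  obtain ⟨T, -, hev⟩ := h.exists_finset_localSection hpr hf (B.proj p)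
  refine (B.formSum_apply_eq_sum hη hev.self_of_nhds _).trans ?_
  rw [fiberSum, h.finsum_src_fiber hev.self_of_nhds (F := fun γ => f (𝒢.tgt γ))
      fun γ _ hγ => image_eq_zero_of_notMem_tsupport hγ, Finset.sum_smul]
  refine Finset.sum_congr rfl fun γ hγ => ?_
  have hsrc := h.src_localSection γ (hev.self_of_nhds.1 γ hγ)
  rw [← B.proj_gact _ _ hsrc, ← hfund]
  exact congrArg (η _) (B.dTranslate_fundamental hsrc X)

/-- The actions commute, and `p` and `p · g` lie over the same point, so the same finite set of
sections serves both and equivariance holds term by term. -/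
theorem formSum_dRight (hpr : 𝒢.IsProper) (hK : IsCompact K)
    (hη : ∀ p, B.proj p ∉ K → η p = 0) {g : G} {A : EG →L[ℝ] EG}
    (hequi : ∀ (p : P) (v : EP), η (B.act p g) (B.dRight g p v) = A (η p v)) (p : P) (v : EP) :
    B.formSum h η (B.act p g) (B.dRight g p v) = A (B.formSum h η p v) := by
  obtain ⟨T, -, hev⟩ := h.exists_finset_localSection hpr hK (B.proj p)
  have hT := hev.self_of_nhds
  rw [B.formSum_apply_eq_sum hη hT, map_sum,
    B.formSum_apply_eq_sum hη (p := B.act p g) (T := T) (by rwa [B.proj_act])]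
  refine Finset.sum_congr rfl fun γ hγ => ?_
  have hsrc := h.src_localSection γ (hT.1 γ hγ)
  have key := congrArg (fun L : EP →L[ℝ] EP => L v) (B.dTranslate_dRight (h := h) hsrc g)
  simp only [ContinuousLinearMap.comp_apply] at key
  rw [B.proj_act, pullback, pullback, ContinuousLinearMap.comp_apply,
    ContinuousLinearMap.comp_apply, key, B.gact_act _ _ _ hsrc, hequi]

/-- The sum over the source fibres turns a compactly supported weighted connection form into a
weighted connection form. -/
theorem isWeightedConnectionForm_formSum [IsManifold 𝓘(ℝ, EP) ∞ P] (hpr : 𝒢.IsProper) {f : M → ℝ}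
    {θ : ∀ p : P, TangentSpace 𝓘(ℝ, EP) p →L[ℝ] GroupLieAlgebra 𝓘(ℝ, EG) G}
    (hθ : B.IsWeightedConnectionForm f θ) (hf : HasCompactSupport f)
    (h0 : ∀ p, B.proj p ∉ tsupport f → θ p = 0) :
    B.IsWeightedConnectionForm (𝒢.fiberSum f) (B.formSum h (θ : P → EP →L[ℝ] EG)) where
  smooth_weight := h.contMDiff_fiberSum hpr hf hθ.smooth_weight
  smooth := B.contMDiff_formSum hpr hf h0 hθ.smooth
  apply_fundamental := B.formSum_fundamental hpr hf h0 hθ.apply_fundamental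
  equivariant p g v :=
    B.formSum_dRight hpr hf h0 (A := lieAd EG g⁻¹) (fun p v => hθ.equivariant p g v) p v

theorem boundary_formSum (hpr : 𝒢.IsProper) (hK : IsCompact K)
    (hη : ∀ p, B.proj p ∉ K → η p = 0) (q : B.Q) : B.boundary (B.formSum h η) q = 0 := by
  refine LinearMap.ext fun w => ?_
  change (B.formSum h η q.1.2 (B.dSource q w : EP) -
    B.formSum h η (B.gact q.1.1 q.1.2) (B.dTarget q w : EP) : EG) = 0
  rw [sub_eq_zero, B.dTarget_apply h q w]
  exact (B.formSum_dTranslate hpr hK hη q.2 _).symm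

end

end GroupoidPrincipalBundle

/-! ### Normalizing coefficients and the resulting connection -/

/-- Nonnegative smooth functions `f n` without a common zero admit smooth coefficients `a n`,
locally zero for almost all `n` and depending on the values of the `f n` only, with `∑ a n * f n = 1`. -/
theorem exists_smooth_coefficients {E M : Type*} [NormedAddCommGroup E] [NormedSpace ℝ E]
    [TopologicalSpace M] [ChartedSpace E M] {f : ℕ → M → ℝ}
    (hs : ∀ n, ContMDiff 𝓘(ℝ, E) 𝓘(ℝ, ℝ) ∞ (f n)) (h0 : ∀ n x, 0 ≤ f n x)
    (hpos : ∀ x, ∃ n, 0 < f n x) :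
    ∃ a : ℕ → M → ℝ, (∀ n, ContMDiff 𝓘(ℝ, E) 𝓘(ℝ, ℝ) ∞ (a n)) ∧
      (∀ x, ∃ N, ∀ᶠ y in 𝓝 x, ∀ n ≥ N, a n y = 0) ∧
      (∀ x N, (∀ n ≥ N, a n x = 0) → ∑ n ∈ Finset.range N, a n x * f n x = 1) ∧
      ∀ x y, (∀ n, f n x = f n y) → ∀ n, a n x = a n y := by
  -- `w n y` is nonzero exactly if `n * f i y < 1` for all `i < n`. A positive value of some `f k`
  -- thus kills all large `n` locally.
  let w : ℕ → M → ℝ := fun n y => ∏ i ∈ Finset.range n, Real.smoothTransition (1 - n * f i y)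
  let S : M → ℝ := fun y => ∑ᶠ n, w n y * f n y
  have hw0 : ∀ n y, 0 ≤ w n y := fun n y =>
    Finset.prod_nonneg fun i _ => Real.smoothTransition.nonneg _
  have hwsm : ∀ n, ContMDiff 𝓘(ℝ, E) 𝓘(ℝ, ℝ) ∞ (w n) := fun n =>
    contMDiff_finsetProd fun i _ => Real.smoothTransition.contDiff.contMDiff.comp
      (contMDiff_const.sub (contMDiff_const.mul (hs i)))
  have hloc : ∀ x, ∃ N, ∀ᶠ y in 𝓝 x, ∀ n ≥ N, w n y = 0 := by
    intro x
    obtain ⟨k, hk⟩ := hpos x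
    -- Near `x`, `f k` exceeds `f k x / 2`, so `n ≥ m` forces `n * f k y > 1`; `n ≥ k + 1` makes `k`
    -- one of the factors.
    obtain ⟨m, hm⟩ := exists_nat_gt (2 / f k x)
    refine ⟨max m (k + 1), ?_⟩
    filter_upwards [(hs k).continuous.continuousAt.eventually (lt_mem_nhds (half_lt_self hk))]
      with y hy n hn
    refine Finset.prod_eq_zero (i := k) (Finset.mem_range.2 (by omega)) ?_
    apply Real.smoothTransition.zero_of_nonpos
    have h1 : (m : ℝ) ≤ n := by exact_mod_cast (le_max_left _ _).trans hn
    have h2 : 2 < n * f k x := (div_lt_iff₀ hk).1 (hm.trans_le h1)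
    have h3 : (n : ℝ) * (f k x / 2) ≤ n * f k y := mul_le_mul_of_nonneg_left hy.le n.cast_nonneg
    linarith
  have hS : ∀ y N, (∀ n ≥ N, w n y = 0) → S y = ∑ n ∈ Finset.range N, w n y * f n y := by
    intro y N hN
    refine finsum_eq_sum_of_support_subset _ fun n hn => ?_
    by_contra hlt
    exact hn (by simp only [hN n (by simpa using hlt), zero_mul])
  have hSsm : ContMDiff 𝓘(ℝ, E) 𝓘(ℝ, ℝ) ∞ S := by
    intro x
    obtain ⟨N, hN⟩ := hloc x
    have : ContMDiffAt 𝓘(ℝ, E) 𝓘(ℝ, ℝ) ∞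
        (fun y => ∑ n ∈ Finset.range N, w n y * f n y) x :=
      contMDiffAt_finsetSum fun n _ => ((hwsm n).mul (hs n)).contMDiffAt
    refine this.congr_of_eventuallyEq ?_
    filter_upwards [hN] with y hy using hS y N hy
  have hSpos : ∀ y, 0 < S y := by
    intro y
    obtain ⟨N, hN⟩ := hloc y
    -- For the least `k` with `f k y > 0` all earlier `f i` vanish at `y`, so every factor of `w k
    -- y` is positive.
    have hk := Nat.find_spec (hpos y)
    set k := Nat.find (hpos y)
    have hwk : 0 < w k y := Finset.prod_pos fun i hi => by
      have : f i y = 0 := le_antisymm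
        (not_lt.1 (Nat.find_min (hpos y) (Finset.mem_range.1 hi))) (h0 i y)
      rw [this]
      exact Real.smoothTransition.pos_of_pos (by simp)
    rw [hS y N hN.self_of_nhds]
    refine Finset.sum_pos' (fun n _ => mul_nonneg (hw0 n y) (h0 n y)) ⟨k, ?_, mul_pos hwk hk⟩
    by_contra hlt
    exact hwk.ne' (hN.self_of_nhds k (by simpa using hlt))
  refine ⟨fun n y => w n y * (S y)⁻¹, fun n => (hwsm n).mul (hSsm.inv₀ fun y => (hSpos y).ne'),
    fun x => ?_, fun x N hN => ?_, fun x y hxy n => ?_⟩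
  · obtain ⟨N, hN⟩ := hloc x
    exact ⟨N, hN.mono fun y hy n hn => by simp only [hy n hn, zero_mul]⟩
  · have hw : ∀ n ≥ N, w n x = 0 := fun n hn =>
      (mul_eq_zero.1 (hN n hn)).resolve_right (inv_ne_zero (hSpos x).ne')
    have : ∑ n ∈ Finset.range N, w n x * (S x)⁻¹ * f n x = S x * (S x)⁻¹ := by
      rw [hS x N hw, Finset.sum_mul]
      exact Finset.sum_congr rfl fun n _ => by ring
    rw [this, mul_inv_cancel₀ (hSpos x).ne']
  · have hw : ∀ n, w n x = w n y := fun n => by simp only [w, hxy]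
    simp only [S, hw, hxy]

namespace SmoothPrincipalBundle

variable {E₀ M EG G EP P : Type*}
  [NormedAddCommGroup E₀] [NormedSpace ℝ E₀] [TopologicalSpace M] [ChartedSpace E₀ M]
  [NormedAddCommGroup EG] [NormedSpace ℝ EG] [TopologicalSpace G] [ChartedSpace EG G] [Group G]
  [NormedAddCommGroup EP] [NormedSpace ℝ EP] [TopologicalSpace P] [ChartedSpace EP P]
  (B : SmoothPrincipalBundle E₀ M EG G EP P)

/-- The combination of forms on `P` with coefficients that are functions on the base. -/
def combination (a : ℕ → M → ℝ) (η : ℕ → P → EP →L[ℝ] EG) (p : P) : EP →L[ℝ] EG :=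
  ∑ᶠ n, a n (B.proj p) • η n p

variable {B} {a : ℕ → M → ℝ}

theorem combination_apply {η : ℕ → P → EP →L[ℝ] EG} {N : ℕ} {p : P}
    (hN : ∀ n ≥ N, a n (B.proj p) = 0) (v : EP) :
    B.combination a η p v = ∑ n ∈ Finset.range N, a n (B.proj p) • η n p v := by
  have : B.combination a η p = ∑ n ∈ Finset.range N, a n (B.proj p) • η n p := by
    refine finsum_eq_sum_of_support_subset _ fun n hn => ?_
    by_contra hlt
    exact hn (by simp only [hN n (by simpa using hlt), zero_smul])
  rw [this, sum_apply]
  rfl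

/-- The weights add up to `∑ a n * f n = 1`; the coefficients are pulled back from the base, hence
constant along `G`-orbits, which preserves equivariance. -/
theorem isConnectionForm_combination [IsManifold 𝓘(ℝ, EP) ∞ P]
    {f : ℕ → M → ℝ}
    {θ : ℕ → ∀ p : P, TangentSpace 𝓘(ℝ, EP) p →L[ℝ] GroupLieAlgebra 𝓘(ℝ, EG) G}
    (hθ : ∀ n, B.IsWeightedConnectionForm (f n) (θ n))
    (hs : ∀ n, ContMDiff 𝓘(ℝ, E₀) 𝓘(ℝ, ℝ) ∞ (a n))
    (hloc : ∀ x, ∃ N, ∀ᶠ y in 𝓝 x, ∀ n ≥ N, a n y = 0)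
    (hsum : ∀ x N, (∀ n ≥ N, a n x = 0) → ∑ n ∈ Finset.range N, a n x * f n x = 1) :
    B.IsConnectionForm (B.combination a (θ : ℕ → P → EP →L[ℝ] EG)) := by
  refine ⟨fun v₀ => ?_, fun p X => ?_, fun p g v => ?_⟩
  · obtain ⟨N, hN⟩ := hloc (B.proj v₀.proj)
    have hproj : ContMDiff 𝓘(ℝ, EP).tangent 𝓘(ℝ, E₀) ∞
        fun v : TangentBundle 𝓘(ℝ, EP) P => B.proj v.proj :=
      B.smooth_proj.comp (Bundle.contMDiff_proj _)
    have hsm : ContMDiffAt 𝓘(ℝ, EP).tangent 𝓘(ℝ, EG) ∞ (M' := EG)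
        (fun v : TangentBundle 𝓘(ℝ, EP) P => ∑ n ∈ Finset.range N,
          (a n (B.proj v.proj) • (θ n v.proj v.2 : EG) : EG)) v₀ :=
      contMDiffAt_finsetSum fun n _ =>
        (((hs n).comp hproj).contMDiffAt).smul (M := EG) (hθ n).smooth.contMDiffAt
    refine hsm.congr_of_eventuallyEq ?_
    filter_upwards [hproj.continuous.continuousAt.eventually hN] with v hv
    exact combination_apply hv (v.2 : EP)
  · obtain ⟨N, hN⟩ := hloc (B.proj p)
    have hN := hN.self_of_nhds
    refine (combination_apply hN (B.fundamental p X : EP)).trans ?_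
    have : ∑ n ∈ Finset.range N, (a n (B.proj p) * f n (B.proj p)) • (X : EG) = X := by
      rw [← Finset.sum_smul, hsum _ N hN, one_smul]
    refine Eq.trans (Finset.sum_congr rfl fun n _ => ?_) this
    rw [mul_smul]
    exact congrArg (fun Y : EG => a n (B.proj p) • Y) ((hθ n).apply_fundamental p X)
  · obtain ⟨N, hN⟩ := hloc (B.proj p)
    have hN := hN.self_of_nhds
    let A : EG →L[ℝ] EG := lieAd EG g⁻¹
    let w : EP := mfderiv 𝓘(ℝ, EP) 𝓘(ℝ, EP) (fun r : P => B.act r g) p v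
    change B.combination a (θ : ℕ → P → EP →L[ℝ] EG) (B.act p g) w =
      A (B.combination a (θ : ℕ → P → EP →L[ℝ] EG) p (v : EP))
    refine (combination_apply (by rwa [B.proj_act]) w).trans
      (Eq.trans ?_ (congrArg A (combination_apply hN (v : EP))).symm)
    rw [map_sum, B.proj_act]
    refine Finset.sum_congr rfl fun n _ => ?_
    rw [map_smul]
    exact congrArg (fun Y : EG => a n (B.proj p) • Y) ((hθ n).equivariant p g v)

end SmoothPrincipalBundle

namespace GroupoidPrincipalBundle

variable {E₀ M E₁ Γ EG G EP P : Type*}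
  [NormedAddCommGroup E₀] [NormedSpace ℝ E₀] [TopologicalSpace M] [ChartedSpace E₀ M]
  [NormedAddCommGroup E₁] [NormedSpace ℝ E₁] [TopologicalSpace Γ] [ChartedSpace E₁ Γ]
  [NormedAddCommGroup EG] [NormedSpace ℝ EG] [TopologicalSpace G] [ChartedSpace EG G] [Group G]
  [NormedAddCommGroup EP] [NormedSpace ℝ EP] [TopologicalSpace P] [ChartedSpace EP P]
  {𝒢 : LieGroupoid E₀ M E₁ Γ} (B : GroupoidPrincipalBundle 𝒢 EG G EP P)

/-- An invariant coefficient has the same value at both ends of an arrow of `Q`, so it factors out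
of the boundary. -/
theorem boundary_combination {a : ℕ → M → ℝ} {η : ℕ → P → EP →L[ℝ] EG}
    (hη : ∀ n q, B.boundary (η n) q = 0) (hloc : ∀ x, ∃ N, ∀ᶠ y in 𝓝 x, ∀ n ≥ N, a n y = 0)
    (hinv : ∀ n γ, a n (𝒢.tgt γ) = a n (𝒢.src γ)) (q : B.Q) :
    B.boundary (B.combination a η) q = 0 := by
  refine LinearMap.ext fun w => ?_
  change (B.combination a η q.1.2 (B.dSource q w : EP) -
    B.combination a η (B.gact q.1.1 q.1.2) (B.dTarget q w : EP) : EG) = 0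
  have hq : 𝒢.src q.1.1 = B.proj q.1.2 := q.2
  obtain ⟨N, hN⟩ := hloc (B.proj q.1.2)
  have hN := hN.self_of_nhds
  have ha : ∀ n, a n (B.proj (B.gact q.1.1 q.1.2)) = a n (B.proj q.1.2) := fun n => by
    rw [B.proj_gact _ _ hq, hinv, hq]
  have hsub : ∀ v v' : EP, B.combination a η q.1.2 v - B.combination a η (B.gact q.1.1 q.1.2) v' =
      ∑ n ∈ Finset.range N, a n (B.proj q.1.2) • (η n q.1.2 v - η n (B.gact q.1.1 q.1.2) v') := by
    intro v v'
    rw [SmoothPrincipalBundle.combination_apply hN,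
      SmoothPrincipalBundle.combination_apply (N := N) fun n hn => (ha n).trans (hN n hn),
      ← Finset.sum_sub_distrib]
    exact Finset.sum_congr rfl fun n _ => by rw [ha, ← smul_sub]
  refine (hsub _ _).trans (Finset.sum_eq_zero fun n _ => ?_)
  have h1 : (η n q.1.2 (B.dSource q w : EP) -
      η n (B.gact q.1.1 q.1.2) (B.dTarget q w : EP) : EG) = 0 :=
    congrArg (fun L : B.tangentQ q →ₗ[ℝ] GroupLieAlgebra 𝓘(ℝ, EG) G => L w) (hη n q)
  exact (congrArg (fun Y : EG => a n (B.proj q.1.2) • Y) h1).trans (smul_zero _)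

/-- A countable family of weighted connection forms with vanishing boundary whose weights are
invariant, nonnegative and without a common zero yields a connection. -/
theorem exists_isConnection_of_weighted [IsManifold 𝓘(ℝ, EP) ∞ P] {f : ℕ → M → ℝ}
    {θ : ℕ → ∀ p : P, TangentSpace 𝓘(ℝ, EP) p →L[ℝ] GroupLieAlgebra 𝓘(ℝ, EG) G}
    (hθ : ∀ n, B.IsWeightedConnectionForm (f n) (θ n)) (hb : ∀ n q, B.boundary (θ n) q = 0)
    (hinv : ∀ n γ, f n (𝒢.tgt γ) = f n (𝒢.src γ)) (h0 : ∀ n x, 0 ≤ f n x)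
    (hpos : ∀ x, ∃ n, 0 < f n x) :
    ∃ θ : ∀ p : P, TangentSpace 𝓘(ℝ, EP) p →L[ℝ] GroupLieAlgebra 𝓘(ℝ, EG) G,
      B.IsConnection θ := by
  obtain ⟨a, hs, hloc, hsum, ha⟩ :=
    exists_smooth_coefficients (fun n => (hθ n).smooth_weight) h0 hpos
  exact ⟨_, SmoothPrincipalBundle.isConnectionForm_combination hθ hs hloc hsum,
    B.boundary_combination hb hloc fun n γ => ha _ _ (fun k => hinv k γ) n⟩

end GroupoidPrincipalBundle

end

theorem theoremE
    {E₀ M E₁ Γ EG G EP P : Type*}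
    -- the manifold `M` of units
    [NormedAddCommGroup E₀] [NormedSpace ℝ E₀] [FiniteDimensional ℝ E₀]
    [TopologicalSpace M] [ChartedSpace E₀ M] [IsManifold 𝓘(ℝ, E₀) ∞ M]
    [T2Space M] [SecondCountableTopology M]
    -- the manifold `Γ` of arrows
    [NormedAddCommGroup E₁] [NormedSpace ℝ E₁] [FiniteDimensional ℝ E₁]
    [TopologicalSpace Γ] [ChartedSpace E₁ Γ] [IsManifold 𝓘(ℝ, E₁) ∞ Γ] [T2Space Γ]
    -- the Lie group `G`
    [NormedAddCommGroup EG] [NormedSpace ℝ EG] [FiniteDimensional ℝ EG]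
    [TopologicalSpace G] [ChartedSpace EG G] [Group G] [LieGroup 𝓘(ℝ, EG) ∞ G]
    -- the total space `P`
    [NormedAddCommGroup EP] [NormedSpace ℝ EP] [FiniteDimensional ℝ EP]
    [TopologicalSpace P] [ChartedSpace EP P] [IsManifold 𝓘(ℝ, EP) ∞ P]
    -- an orbifold, and a principal `G`-bundle over it
    (𝒢 : LieGroupoid E₀ M E₁ Γ) (h_etale : 𝒢.IsEtale) (h_proper : 𝒢.IsProper)
    (B : GroupoidPrincipalBundle 𝒢 EG G EP P) :
    ∃ θ : ∀ p : P, TangentSpace 𝓘(ℝ, EP) p →L[ℝ] GroupLieAlgebra 𝓘(ℝ, EG) G,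
      B.IsConnection θ := by
  have : LocallyCompactSpace M := ChartedSpace.locallyCompactSpace E₀ M
  choose f θ hθ h0 hpos hf hsupp using
    fun x : M => B.toSmoothPrincipalBundle.exists_isWeightedConnectionForm x
  obtain ⟨s, hs, hcov⟩ := TopologicalSpace.countable_cover_nhds (f := fun x => {y | 0 < f x y})
    fun x => (hθ x).smooth_weight.continuous.continuousAt.eventually (lt_mem_nhds (hpos x))
  -- Enumerating the countable cover by `ℕ` needs a point; without one, `M` and hence `P` are empty
  -- and every form is a connection.
  rcases s.eq_empty_or_nonempty with rfl | hne
  · have hM : IsEmpty M := by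
      rw [← Set.univ_eq_empty_iff, ← hcov]
      simp
    have hP : IsEmpty P := ⟨fun p => hM.false (B.proj p)⟩
    exact ⟨fun p => (hP.false p).elim, ⟨fun v => (hP.false v.proj).elim,
      fun p => (hP.false p).elim, fun p => (hP.false p).elim⟩, fun q => (hP.false q.1.2).elim⟩
  obtain ⟨c, rfl⟩ := hs.exists_eq_range hne
  refine B.exists_isConnection_of_weighted
    (fun n => B.isWeightedConnectionForm_formSum (h := h_etale) h_proper (hθ (c n)) (hf (c n))
      (hsupp (c n)))
    (fun n q => B.boundary_formSum h_proper (hf (c n)) (hsupp (c n)) q)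
    (fun n γ => 𝒢.fiberSum_tgt (f (c n)) γ) (fun n x => 𝒢.fiberSum_nonneg (h0 (c n)) x)
    fun x => ?_
  have hx : x ∈ ⋃ y ∈ Set.range c, {z | 0 < f y z} := hcov ▸ Set.mem_univ x
  obtain ⟨_, ⟨n, rfl⟩, hn⟩ := Set.mem_iUnion₂.1 hx
  exact ⟨n, h_etale.fiberSum_pos h_proper (hf (c n)) (h0 (c n)) hn⟩
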